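/- Consider a vehicle moving in the horizontal plane, with pose $\eta=(x,y,\varrho)\in\mathbb R^3$, body-frame velocity $\nu=(u,v,r)\in\mathbb R^3$, control $\tau$ and disturbance $\tau_w$, governed by $$\dot\eta=R(\varrho)\nu,\qquad M\dot\nu+C(\nu)\nu+D(\nu)\nu=\tau+\tau_w,\qquad R(\varrho)=\begin{bmatrix}\cos\varrho&-\sin\varrho&0\\ \sin\varrho&\cos\varrho&0\\0&0&1\end{bmatrix},$$ where $M=\mathrm{diag}(m_{11},m_{22},m_{33})$ with $m_{11}=m-X_{\dot u}$, $m_{22}=m-Y_{\dot v}$, $m_{33}=I_z-N_{\dot r}$, $$C(\nu)=\begin{bmatrix}0&0&-m_{22}v\\0&0&m_{11}u\\m_{22}v&-m_{11}u&0\end{bmatrix},\qquad D(\nu)=\mathrm{diag}\big(-X_u-X_{u|u|}|u|,\;-Y_v-Y_{v|v|}|v|,\;-N_r-N_{r|r|}|r|\big).$$ Assume that $M$ is positive definite and that $D(\nu)$ is positive definite for every $\nu$. Let $\eta_{\rm ref}:\mathbb R\to\mathbb R^3$ be a twice continuously differentiable reference, and put $\tilde\eta=\eta_{\rm ref}-\eta$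 and $\tilde\nu=\dot{\tilde\eta}=\dot\eta_{\rm ref}-R(\varrho)\nu$. With $R=R(\varrho)$, $\dot R=\frac{d}{dt}R(\varrho(t))$, $M(\eta)=R^{-T}MR^{-1}$, $C(\nu,\eta)=R^{-T}[C(\nu)-MR^{-1}\dot R]R^{-1}$ and $D(\nu,\eta)=R^{-T}D(\nu)R^{-1}$, the NLPD tracking controller is $$\tau=R^T\big[M(\eta)\ddot\eta_{\rm ref}+C(\nu,\eta)\dot\eta_{\rm ref}+D(\nu,\eta)\dot\eta_{\rm ref}+K_p\tilde\eta+K_v\tilde\nu\big],$$ where $K_p=\mathrm{diag}(k_{p1},k_{p2},k_{p3})$, $K_v=\mathrm{diag}(k_{v1},k_{v2},k_{v3})$ and, for $j=1,2,3$, $$k_{pj}=\begin{cases}a_{pj}|\tilde\eta_j|^{\mu_{pj}-1}&\text{if }|\tilde\eta_j|\ge b_{pj},\\ a_{pj}b_{pj}^{\mu_{pj}-1}&\text{if }|\tilde\eta_j|<b_{pj},\end{cases}\qquad k_{vj}=\begin{cases}a_{vj}|\tilde\nu_j|^{\mu_{vj}-1}&\text{if }|\tilde\nu_j|\ge b_{vj},\\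 a_{vj}b_{vj}^{\mu_{vj}-1}&\text{if }|\tilde\nu_j|<b_{vj},\end{cases}$$ with constants $a_{pj},a_{vj},b_{pj},b_{vj}>0$ and $\mu_{pj},\mu_{vj}\in[0,1]$. Then: (0) $K_p$ and $K_v$ are positive definite at every value of the errors. (1) If $\tau_w=0$ and $\dot\eta_{\rm ref}$ is bounded on $[0,\infty)$, the origin is globally uniformly asymptotically stable for the closed-loop tracking error $(\tilde\eta,\dot{\tilde\eta})$. That is, from every initial time $t_0\ge0$ and every initial error there is a closed-loop solution on $[t_0,\infty)$, and, with constants independent of $t_0$ and of the solution: for every $\varepsilon>0$ there is $\delta>0$ such that an initial error smaller than $\delta$ gives an error smaller than $\varepsilon$ for all $t\ge t_0$; for every $\rho_0>0$ there is a $\rho_1>0$ such that an initial error smaller than $\rho_0$ gives an error smaller than $\rho_1$ for all $t\ge t_0$; and for all $\rho_0,\varepsilon>0$ there is $S>0$ such that an initial error smaller than $\rho_0$ gives an error smaller than $\varepsilon$ for all $t\ge t_0+S$. (2) There is a number $\varepsilon>0$, depending only on the vehicle and the gain constants, such that for every twice continuously differentiable reference, every bounded measurable disturbance $\tau_w$,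 every $T\ge0$ and every closed-loop solution on $[0,T]$ (with $\nu$ absolutely continuous and its equation holding almost everywhere) with $\tilde\eta(0)=\dot{\tilde\eta}(0)=0$, $$\int_0^T\big(\dot{\tilde\eta}^T\dot{\tilde\eta}-\varepsilon^2\tau_w^T\tau_w\big)\,dt\le0 .$$ -/

import Mathlib

open MeasureTheory
open scoped Matrix

namespace AUV

/-- Column vectors of `ℝ³`. -/
abbrev Vec3 := Fin 3 → ℝ

/-- Square matrices of size three. -/
abbrev Mat3 := Matrix (Fin 3) (Fin 3) ℝ

/-- Physical constants of the vehicle: mass `m`, moment of inertia in yaw `Iz`, added masses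
`Xdu`, `Ydv`, `Ndr`, linear damping coefficients `Xu`, `Yv`, `Nr` and quadratic damping
coefficients `Xuu`, `Yvv`, `Nrr`. -/
structure Params where
  m : ℝ
  Iz : ℝ
  Xdu : ℝ
  Ydv : ℝ
  Ndr : ℝ
  Xu : ℝ
  Yv : ℝ
  Nr : ℝ
  Xuu : ℝ
  Yvv : ℝ
  Nrr : ℝ

namespace Params

variable (P : Params)

def m11 : ℝ := P.m - P.Xdu
def m22 : ℝ := P.m - P.Ydv
def m33 : ℝ := P.Iz - P.Ndr

/-- Inertia matrix in the body frame. -/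
def M : Mat3 := Matrix.diagonal ![P.m11, P.m22, P.m33]

/-- Coriolis and centripetal matrix in the body frame; `ν = (u, v, r)`. -/
def C (ν : Vec3) : Mat3 :=
  !![0, 0, -P.m22 * ν 1;
     0, 0, P.m11 * ν 0;
     P.m22 * ν 1, -P.m11 * ν 0, 0]

/-- Damping matrix in the body frame; `ν = (u, v, r)`. -/
def D (ν : Vec3) : Mat3 :=
  Matrix.diagonal ![-P.Xu - P.Xuu * |ν 0|, -P.Yv - P.Yvv * |ν 1|, -P.Nr - P.Nrr * |ν 2|]

end Params

/-- Rotation from the body frame to the earth-fixed frame at the yaw angle `θ`. -/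
noncomputable def R (θ : ℝ) : Mat3 :=
  !![Real.cos θ, -Real.sin θ, 0;
     Real.sin θ, Real.cos θ, 0;
     0, 0, 1]

/-- Time derivative of `R` at the yaw angle `θ` when the yaw rate is `r`. -/
noncomputable def Rdot (θ r : ℝ) : Mat3 :=
  !![-(r * Real.sin θ), -(r * Real.cos θ), 0;
     r * Real.cos θ, -(r * Real.sin θ), 0;
     0, 0, 0]

theorem hasDerivAt_R_apply {θ : ℝ → ℝ} {r t : ℝ} (h : HasDerivAt θ r t) (i j : Fin 3) :
    HasDerivAt (fun s => R (θ s) i j) (Rdot (θ t) r i j) t := by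
  have hc : HasDerivAt (fun s => Real.cos (θ s)) (-(r * Real.sin (θ t))) t := by
    convert h.cos using 1; ring
  have hs : HasDerivAt (fun s => Real.sin (θ s)) (r * Real.cos (θ t)) t := by
    convert h.sin using 1; ring
  have hn : HasDerivAt (fun s => -Real.sin (θ s)) (-(r * Real.cos (θ t))) t := hs.neg
  have h0 : HasDerivAt (fun _ : ℝ => (0 : ℝ)) 0 t := hasDerivAt_const _ _
  have h1 : HasDerivAt (fun _ : ℝ => (1 : ℝ)) 0 t := hasDerivAt_const _ _
  fin_cases i <;> fin_cases j
  · exact hc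
  · exact hn
  · exact h0
  · exact hs
  · exact hc
  · exact h0
  · exact h0
  · exact h0
  · exact h1

/-- Inertia matrix in the earth-fixed frame; `η = (x, y, ϱ)`. -/
noncomputable def earthM (P : Params) (η : Vec3) : Mat3 :=
  ((R (η 2))⁻¹).transpose * P.M * (R (η 2))⁻¹

/-- Coriolis matrix in the earth-fixed frame; the yaw rate is `ν 2`. -/
noncomputable def earthC (P : Params) (ν η : Vec3) : Mat3 :=
  ((R (η 2))⁻¹).transpose * (P.C ν - P.M * (R (η 2))⁻¹ * Rdot (η 2) (ν 2)) * (R (η 2))⁻¹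

/-- Damping matrix in the earth-fixed frame. -/
noncomputable def earthD (P : Params) (ν η : Vec3) : Mat3 :=
  ((R (η 2))⁻¹).transpose * P.D ν * (R (η 2))⁻¹

/-- Constants of a diagonal nonlinear gain. -/
structure Gain where
  a : Vec3
  b : Vec3
  μ : Vec3

/-- Admissible constants: `a_j, b_j > 0` and `μ_j ∈ [0, 1]`. -/
def Gain.Admissible (G : Gain) : Prop :=
  ∀ j, 0 < G.a j ∧ 0 < G.b j ∧ G.μ j ∈ Set.Icc (0 : ℝ) 1

/-- Scalar nonlinear gain of the `j`-th channel at the scalar error `e`. -/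
noncomputable def Gain.k (G : Gain) (j : Fin 3) (e : ℝ) : ℝ :=
  if G.b j ≤ |e| then G.a j * |e| ^ (G.μ j - 1) else G.a j * G.b j ^ (G.μ j - 1)

/-- Diagonal gain matrix at the error vector `e`. -/
noncomputable def Gain.K (G : Gain) (e : Vec3) : Mat3 :=
  Matrix.diagonal fun j => G.k j (e j)

/-- Position error for the reference `ref` at time `t` when the pose is `η`. -/
def posErr (ref : ℝ → Vec3) (t : ℝ) (η : Vec3) : Vec3 := ref t - η

/-- Velocity error: reference velocity minus the vehicle velocity `R(ϱ) ν`, both in the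
earth-fixed frame. -/
noncomputable def velErr (ref : ℝ → Vec3) (t : ℝ) (η ν : Vec3) : Vec3 :=
  deriv ref t - R (η 2) *ᵥ ν

/-- The nonlinear proportional-derivative tracking law, with position gain `Gp` and velocity
gain `Gv`. -/
noncomputable def control (P : Params) (Gp Gv : Gain) (ref : ℝ → Vec3) (t : ℝ) (η ν : Vec3) :
    Vec3 :=
  (R (η 2)).transpose *ᵥ
    (earthM P η *ᵥ deriv (deriv ref) t + earthC P ν η *ᵥ deriv ref t
      + earthD P ν η *ᵥ deriv ref t
      + Gp.K (posErr ref t η) *ᵥ posErr ref t η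
      + Gv.K (velErr ref t η ν) *ᵥ velErr ref t η ν)

/-- `(η, ν)` solves on `[t₀, T]` the vehicle equations `η' = R(ϱ) ν` and
`M ν' + C(ν) ν + D(ν) ν = τ + w` under the tracking law `τ` and the disturbance `w`
(Carathéodory solution: the velocity is absolutely continuous and its equation holds at almost
every time). -/
structure IsSolutionOn (P : Params) (Gp Gv : Gain) (ref w : ℝ → Vec3) (t₀ T : ℝ)
    (η ν : ℝ → Vec3) : Prop where
  kinematics : ∀ t ∈ Set.Icc t₀ T,
    HasDerivWithinAt η (R (η t 2) *ᵥ ν t) (Set.Icc t₀ T) t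
  absCont : AbsolutelyContinuousOnInterval ν t₀ T
  dynamics : ∀ᵐ t ∂(volume.restrict (Set.Icc t₀ T)), ∃ ν' : Vec3, HasDerivAt ν ν' t ∧
    P.M *ᵥ ν' + P.C (ν t) *ᵥ ν t + P.D (ν t) *ᵥ ν t
      = control P Gp Gv ref t (η t) (ν t) + w t

/-- `x = (η̃, η̃')` is on `[t₀, ∞)` the tracking error of a closed-loop solution without
disturbance. -/
def IsErrorTrajectory (P : Params) (Gp Gv : Gain) (ref : ℝ → Vec3) (t₀ : ℝ)
    (x : ℝ → Vec3 × Vec3) : Prop :=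
  ∃ η ν : ℝ → Vec3, (∀ T, t₀ ≤ T → IsSolutionOn P Gp Gv ref 0 t₀ T η ν) ∧
    ∀ t, t₀ ≤ t → x t = (posErr ref t (η t), velErr ref t (η t) (ν t))

/-- Global uniform asymptotic stability of the origin for a nonautonomous system given by its
solutions: `sol t₀ x` says that `x` is a solution on `[t₀, ∞)`. -/
structure IsGloballyUniformlyAsymptoticallyStable {E : Type*} [NormedAddCommGroup E]
    (sol : ℝ → (ℝ → E) → Prop) : Prop where
  exists_solution : ∀ t₀, 0 ≤ t₀ → ∀ x₀ : E, ∃ x, sol t₀ x ∧ x t₀ = x₀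
  stable : ∀ ε > 0, ∃ δ > 0, ∀ t₀, 0 ≤ t₀ → ∀ x, sol t₀ x → ‖x t₀‖ < δ →
    ∀ t, t₀ ≤ t → ‖x t‖ < ε
  bounded : ∀ r > 0, ∃ ρ > 0, ∀ t₀, 0 ≤ t₀ → ∀ x, sol t₀ x → ‖x t₀‖ < r →
    ∀ t, t₀ ≤ t → ‖x t‖ < ρ
  attractive : ∀ r > 0, ∀ ε > 0, ∃ S > 0, ∀ t₀, 0 ≤ t₀ → ∀ x, sol t₀ x → ‖x t₀‖ < r →
    ∀ t, t₀ + S ≤ t → ‖x t‖ < ε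

end AUV

/-! ### Absolutely continuous functions under locally Lipschitz maps -/

section General

open Set Filter Topology
open scoped NNReal

/-! With `e` the position error, rotate the velocity error into the body frame, `z = Rᵀ η̇_ref - ν`.
The feedforward terms then cancel and the closed loop becomes `e' = R z`, `M z' + C(ν) z + D(ν) z +
Rᵀ (K_p e + K_v R z) + w = 0` (`dynamics_iff`). The energy, `½ zᵀ M z` plus the potentials of the
restoring forces `k_p(s) s`, has rate `-zᵀ D z - (R z)ᵀ K_v (R z) - z ⬝ w`, because `C(ν)` is skew
and the `K_p` terms cancel (`energy_rate`). Pointwise positivity of `D` forces a uniform bound `D ≥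
c > 0` (`exists_damping_ge`), so completing a square yields the finite gain with `ε = 1 / c`.

Without disturbance the energy decreases, but its rate does not control `e`, and the system depends
on time. A small multiple of the cross term `e ⬝ R M z` supplies the missing dissipation in `e`
(`exists_strict_lyapunov`). The constants are uniform in time because the reference velocity is
bounded and everything is periodic in the yaw angle. They do depend on the size of the error, since
the gains may decay at infinity; but the energy is proper, so its sublevel sets confine each
trajectory to a region fixed by the initial error. Exponential decay on each such region gives
global uniform asymptotic stability.

Existence uses the same energy: the error field is locally Lipschitz, and a proper nonincreasing
function excludes blow-up. Solutions are only absolutely continuous, so decay is obtained by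
integrating derivative bounds that hold almost everywhere. -/

theorem AbsolutelyContinuousOnInterval.prodMk {X Y : Type*} [PseudoMetricSpace X]
    [PseudoMetricSpace Y] {f : ℝ → X} {g : ℝ → Y} {a b : ℝ}
    (hf : AbsolutelyContinuousOnInterval f a b) (hg : AbsolutelyContinuousOnInterval g a b) :
    AbsolutelyContinuousOnInterval (fun t => (f t, g t)) a b := by
  refine squeeze_zero (fun E => Finset.sum_nonneg fun i _ => dist_nonneg) (fun E => ?_)
    (by simpa using Tendsto.add hf hg)
  rw [← Finset.sum_add_distrib]
  refine Finset.sum_le_sum fun i _ => ?_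
  rw [Prod.dist_eq]
  exact max_le_add_of_nonneg dist_nonneg dist_nonneg

theorem LipschitzOnWith.comp_absolutelyContinuousOnInterval {X Y : Type*} [PseudoMetricSpace X]
    [PseudoMetricSpace Y] {f : ℝ → X} {g : X → Y} {a b : ℝ} {K : ℝ≥0} {s : Set X}
    (hg : LipschitzOnWith K g s) (hf : AbsolutelyContinuousOnInterval f a b)
    (hs : MapsTo f (uIcc a b) s) :
    AbsolutelyContinuousOnInterval (fun t => g (f t)) a b := by
  rw [absolutelyContinuousOnInterval_iff] at hf ⊢
  intro ε hε
  -- `K + 1` instead of `K`, which may vanish.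
  obtain ⟨δ, hδ, h⟩ := hf (ε / (K + 1)) (by positivity)
  refine ⟨δ, hδ, fun E hE hlt => ?_⟩
  have h1 := h E hE hlt
  have hmem := hE.1
  calc ∑ i ∈ Finset.range E.1, dist (g (f (E.2 i).1)) (g (f (E.2 i).2))
      ≤ ∑ i ∈ Finset.range E.1, (K + 1) * dist (f (E.2 i).1) (f (E.2 i).2) := by
        refine Finset.sum_le_sum fun i hi => ?_
        refine (hg.dist_le_mul _ (hs (hmem i hi).1) _ (hs (hmem i hi).2)).trans ?_
        gcongr
        simp
    _ = (K + 1) * ∑ i ∈ Finset.range E.1, dist (f (E.2 i).1) (f (E.2 i).2) := by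
        rw [Finset.mul_sum]
    _ < (K + 1) * (ε / (K + 1)) := by gcongr
    _ = ε := by field_simp

/-- The image of the interval is compact, so the outer map is Lipschitz on it. This is how energies
become absolutely continuous along Carathéodory solutions. -/
theorem LocallyLipschitz.comp_absolutelyContinuousOnInterval {X Y : Type*}
    [SeminormedAddCommGroup X] [PseudoMetricSpace Y] {f : ℝ → X} {g : X → Y} {a b : ℝ}
    (hg : LocallyLipschitz g) (hf : AbsolutelyContinuousOnInterval f a b) :
    AbsolutelyContinuousOnInterval (fun t => g (f t)) a b := by
  obtain ⟨K, hK⟩ := LocallyLipschitzOn.exists_lipschitzOnWith_of_compact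
    (isCompact_uIcc.image_of_continuousOn hf.continuousOn)
    (hg.locallyLipschitzOn (s := f '' uIcc a b))
  exact hK.comp_absolutelyContinuousOnInterval hf (mapsTo_image _ _)

/-- An absolutely continuous function grows at most by the integral of a bound of its derivative. -/
theorem AbsolutelyContinuousOnInterval.sub_le_integral {f g : ℝ → ℝ} {a b : ℝ} (hab : a ≤ b)
    (hf : AbsolutelyContinuousOnInterval f a b) (hg : IntervalIntegrable g volume a b)
    (h : ∀ᵐ t ∂(volume.restrict (Icc a b)), ∃ d, HasDerivAt f d t ∧ d ≤ g t) :
    f b - f a ≤ ∫ t in a..b, g t := by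
  rw [← hf.integral_deriv_eq_sub]
  refine intervalIntegral.integral_mono_ae_restrict hab hf.intervalIntegrable_deriv hg ?_
  filter_upwards [h] with t ht
  obtain ⟨d, hd, hle⟩ := ht
  rwa [hd.deriv]

theorem AbsolutelyContinuousOnInterval.le_of_ae_deriv_nonpos {f : ℝ → ℝ} {a b : ℝ} (hab : a ≤ b)
    (hf : AbsolutelyContinuousOnInterval f a b)
    (h : ∀ᵐ t ∂(volume.restrict (Icc a b)), ∃ d, HasDerivAt f d t ∧ d ≤ 0) :
    f b ≤ f a := by
  have := hf.sub_le_integral hab (g := fun _ => 0) (by simp) h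
  simp at this
  exact this

/-! ### Calculus of locally Lipschitz maps -/

section LocallyLipschitz

variable {X : Type*} [SeminormedAddCommGroup X]

theorem LocallyLipschitz.finPi {n : ℕ} {f : X → Fin n → ℝ}
    (h : ∀ i, LocallyLipschitz fun x => f x i) : LocallyLipschitz f := by
  intro x
  choose K t ht hK using fun i => h i x
  refine ⟨∑ i, K i, ⋂ i, t i, Filter.iInter_mem.2 ht, ?_⟩
  refine LipschitzOnWith.of_dist_le_mul fun y hy z hz => ?_
  rw [dist_pi_le_iff (by positivity)]
  intro i
  refine ((hK i).dist_le_mul y (mem_iInter.1 hy i) z (mem_iInter.1 hz i)).trans ?_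
  gcongr
  exact Finset.single_le_sum (f := K) (fun _ _ => zero_le) (Finset.mem_univ i)

theorem LocallyLipschitz.eval {n : ℕ} {f : X → Fin n → ℝ} (h : LocallyLipschitz f) (i : Fin n) :
    LocallyLipschitz fun x => f x i :=
  (LipschitzWith.eval (α := fun _ : Fin n => ℝ) i).locallyLipschitz.comp h

/-- Both factors are bounded near a point, and a difference of products splits as in the product
rule. -/
theorem LocallyLipschitz.smul_real {F : Type*} [NormedAddCommGroup F] [NormedSpace ℝ F]
    {c : X → ℝ} {f : X → F} (hc : LocallyLipschitz c) (hf : LocallyLipschitz f) :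
    LocallyLipschitz fun x => c x • f x := by
  intro x
  obtain ⟨K, s, hs, hK⟩ := hc x
  obtain ⟨L, t, ht, hL⟩ := hf x
  have h1 : ∀ᶠ y in 𝓝 x, ‖c y‖ ≤ ‖c x‖ + 1 :=
    (hc.continuous.norm.continuousAt.eventually_lt_const (by simp : ‖c x‖ < ‖c x‖ + 1)).mono
      fun _ h => h.le
  have h2 : ∀ᶠ y in 𝓝 x, ‖f y‖ ≤ ‖f x‖ + 1 :=
    (hf.continuous.norm.continuousAt.eventually_lt_const (by simp : ‖f x‖ < ‖f x‖ + 1)).mono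
      fun _ h => h.le
  refine ⟨(‖c x‖₊ + 1) * L + K * (‖f x‖₊ + 1), _, inter_mem (inter_mem hs ht) (h1.and h2),
    LipschitzOnWith.of_dist_le_mul fun y hy z hz => ?_⟩
  have e1 := hK.dist_le_mul y hy.1.1 z hz.1.1
  have e2 := hL.dist_le_mul y hy.1.2 z hz.1.2
  rw [dist_eq_norm] at e1 e2
  have hcy : ‖c y‖ ≤ ‖c x‖ + 1 := hy.2.1
  have hfz : ‖f z‖ ≤ ‖f x‖ + 1 := hz.2.2
  rw [dist_eq_norm]
  calc ‖c y • f y - c z • f z‖ = ‖c y • (f y - f z) + (c y - c z) • f z‖ := by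
        congr 1; module
    _ ≤ ‖c y‖ * ‖f y - f z‖ + ‖c y - c z‖ * ‖f z‖ := by
        refine (norm_add_le _ _).trans ?_
        rw [norm_smul, norm_smul]
    _ ≤ (‖c x‖ + 1) * (L * dist y z) + (K * dist y z) * (‖f x‖ + 1) := by gcongr
    _ = _ := by push_cast; ring

theorem LocallyLipschitz.mul_real {f g : X → ℝ} (hf : LocallyLipschitz f)
    (hg : LocallyLipschitz g) : LocallyLipschitz fun x => f x * g x :=
  hf.smul_real hg

theorem LocallyLipschitz.sum_real {ι : Type*} (s : Finset ι) {f : ι → X → ℝ}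
    (hf : ∀ i, LocallyLipschitz (f i)) : LocallyLipschitz fun x => ∑ i ∈ s, f i x := by
  classical
  induction s using Finset.induction_on with
  | empty => simpa using LocallyLipschitz.const (0 : ℝ)
  | insert a s ha ih => simpa [Finset.sum_insert ha] using (hf a).add ih

theorem LocallyLipschitz.comp_contDiffAt {f : X → ℝ} {g : ℝ → ℝ} (hf : LocallyLipschitz f)
    (hg : ∀ x, ContDiffAt ℝ 1 g (f x)) : LocallyLipschitz fun x => g (f x) := by
  intro x
  obtain ⟨K, s, hs, hK⟩ := (hg x).exists_lipschitzOnWith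
  obtain ⟨L, t, ht, hL⟩ := hf x
  exact ⟨K * L, t ∩ f ⁻¹' s, inter_mem ht (hf.continuous.continuousAt hs),
    hK.comp (hL.mono inter_subset_left) fun y hy => hy.2⟩

theorem LocallyLipschitz.dotProduct {n : ℕ} {v w : X → Fin n → ℝ} (hv : LocallyLipschitz v)
    (hw : LocallyLipschitz w) : LocallyLipschitz fun x => v x ⬝ᵥ w x :=
  LocallyLipschitz.sum_real _ fun i => (hv.eval i).mul_real (hw.eval i)

theorem LocallyLipschitz.mulVec {m n : ℕ} {A : X → Matrix (Fin m) (Fin n) ℝ} {v : X → Fin n → ℝ}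
    (hA : ∀ i j, LocallyLipschitz fun x => A x i j) (hv : LocallyLipschitz v) :
    LocallyLipschitz fun x => A x *ᵥ v x :=
  LocallyLipschitz.finPi fun i =>
    LocallyLipschitz.dotProduct (LocallyLipschitz.finPi (hA i)) hv

end LocallyLipschitz

/-! ### Global existence from a proper Lyapunov function -/

section GlobalExistence

variable {E : Type*} [NormedAddCommGroup E] [NormedSpace ℝ E] [ProperSpace E]

/-- A locally Lipschitz vector field with a proper Lyapunov function has solutions on every compact
interval, and they stay in a bounded region. -/
theorem exists_hasDerivWithinAt_Icc_of_lyapunov {f : ℝ × E → E} (hf : LocallyLipschitz f)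
    {V : E → ℝ} (hV : Differentiable ℝ V) (hdec : ∀ t x, lineDeriv ℝ V x (f (t, x)) ≤ 0)
    {x₀ : E} {ρ : ℝ} (hρ : ∀ x, V x ≤ V x₀ → ‖x‖ ≤ ρ) {t₀ T : ℝ} (hT : t₀ ≤ T) :
    ∃ x : ℝ → E, x t₀ = x₀ ∧ ∀ t ∈ Icc t₀ T,
      HasDerivWithinAt x (f (t, x t)) (Icc t₀ T) t ∧ ‖x t‖ ≤ ρ := by
  -- The cutoff is `1` on the ball of radius `ρ` and `0` outside radius `ρ + 1`. The truncated field
  -- is bounded, so Picard–Lindelöf covers the whole interval at once. Since `χ ≥ 0`, `V` still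
  -- decreases along it; the solution stays where `χ = 1` and solves the original equation.
  set χ : E → ℝ := fun x => max 0 (min 1 (ρ + 1 - ‖x‖)) with hχ
  have hχ0 : ∀ x, 0 ≤ χ x := fun x => le_max_left _ _
  have hχ1 : ∀ x, χ x ≤ 1 := fun x => max_le zero_le_one (min_le_left _ _)
  have hχL : LocallyLipschitz χ :=
    ((((LocallyLipschitz.const (ρ + 1)).sub lipschitzWith_one_norm.locallyLipschitz).const_min
      1).const_max 0)
  set g : ℝ × E → E := fun p => χ p.2 • f p with hg
  have hgL : LocallyLipschitz g :=
    (hχL.comp LipschitzWith.prod_snd.locallyLipschitz).smul_real hf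
  obtain ⟨L, hL⟩ := (isCompact_Icc.prod (isCompact_closedBall (0 : E) (ρ + 1))
    (s := Icc t₀ T)).exists_bound_of_continuousOn hf.continuous.continuousOn
  have hgb : ∀ t ∈ Icc t₀ T, ∀ x, ‖g (t, x)‖ ≤ max L 0 := by
    intro t ht x
    by_cases hx : ‖x‖ ≤ ρ + 1
    · have h1 : ‖f (t, x)‖ ≤ L := hL _ ⟨ht, by simpa using hx⟩
      rw [hg]
      simp only [norm_smul, Real.norm_eq_abs, abs_of_nonneg (hχ0 x)]
      calc χ x * ‖f (t, x)‖ ≤ 1 * L := by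
            gcongr
            exact hχ1 x
        _ ≤ _ := by simp
    · have : χ x = 0 := by
        simp only [hχ]
        refine max_eq_left ((min_le_right _ _).trans ?_)
        linarith
      simp [hg, this]
  -- The largest distance a curve of speed at most `max L 0` can travel in this time.
  set a : ℝ := max L 0 * (T - t₀) with ha
  have ha0 : 0 ≤ a := mul_nonneg (le_max_right _ _) (by linarith)
  obtain ⟨K, hK⟩ := LocallyLipschitzOn.exists_lipschitzOnWith_of_compact
    (isCompact_Icc.prod (isCompact_closedBall x₀ a) (s := Icc t₀ T))
    hgL.locallyLipschitzOn
  have hPL : IsPicardLindelof (fun t x => g (t, x)) (⟨t₀, left_mem_Icc.2 hT⟩ : Icc t₀ T) x₀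
      ⟨a, ha0⟩ 0 ⟨max L 0, le_max_right _ _⟩ K :=
    { lipschitzOnWith := fun t ht => LipschitzOnWith.of_dist_le_mul fun x hx y hy => by
        have := hK.dist_le_mul (t, x) ⟨ht, hx⟩ (t, y) ⟨ht, hy⟩
        simpa [Prod.dist_eq] using this
      continuousOn := fun x _ =>
        (hgL.continuous.comp (by fun_prop : Continuous fun t : ℝ => (t, x))).continuousOn
      norm_le := fun t ht x _ => hgb t ht x
      mul_max_le := by
        have h : max (T - t₀) (t₀ - t₀) = T - t₀ := max_eq_left (by linarith)
        show max L 0 * max (T - t₀) (t₀ - t₀) ≤ a - 0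
        rw [h, sub_zero] }
  obtain ⟨x, hx0, hx⟩ := hPL.exists_eq_forall_mem_Icc_hasDerivWithinAt₀
  simp only at hx0 hx
  have hline : ∀ t y, fderiv ℝ V y (g (t, y)) ≤ 0 := by
    intro t y
    rw [hg]
    simp only [map_smul, smul_eq_mul]
    refine mul_nonpos_of_nonneg_of_nonpos (hχ0 y) ?_
    rw [← (hV y).lineDeriv_eq_fderiv]
    exact hdec t y
  have hVx : ∀ t ∈ Icc t₀ T,
      HasDerivWithinAt (fun s => V (x s)) (fderiv ℝ V (x t) (g (t, x t))) (Icc t₀ T) t :=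
    fun t ht => (hV (x t)).hasFDerivAt.comp_hasDerivWithinAt t (hx t ht)
  have hanti : AntitoneOn (fun s => V (x s)) (Icc t₀ T) := by
    refine antitoneOn_of_hasDerivWithinAt_nonpos (convex_Icc _ _)
      (fun t ht => (hVx t ht).continuousWithinAt)
      (fun t ht => (hVx t (interior_subset ht)).mono interior_subset)
      (fun t _ => hline t (x t))
  have hb : ∀ t ∈ Icc t₀ T, ‖x t‖ ≤ ρ := fun t ht => hρ _ (by
    have := hanti (left_mem_Icc.2 hT) ht ht.1
    simpa [hx0] using this)
  refine ⟨x, hx0, fun t ht => ⟨?_, hb t ht⟩⟩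
  have h1 : χ (x t) = 1 := by
    have := hb t ht
    simp only [hχ]
    rw [min_eq_left (by linarith), max_eq_right zero_le_one]
  simpa [hg, h1] using hx t ht

/-- A locally Lipschitz vector field with a proper Lyapunov function has forward global
solutions. -/
theorem exists_hasDerivWithinAt_Ici_of_lyapunov {f : ℝ × E → E} (hf : LocallyLipschitz f)
    {V : E → ℝ} (hV : Differentiable ℝ V) (hdec : ∀ t x, lineDeriv ℝ V x (f (t, x)) ≤ 0)
    (hcoer : ∀ c, ∃ ρ, ∀ x, V x ≤ c → ‖x‖ ≤ ρ) (t₀ : ℝ) (x₀ : E) :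
    ∃ x : ℝ → E, x t₀ = x₀ ∧ ∀ t, t₀ ≤ t → HasDerivWithinAt x (f (t, x t)) (Ici t₀) t := by
  obtain ⟨ρ, hρ⟩ := hcoer (V x₀)
  -- All these solutions lie in one ball, whose radius does not depend on `n`; a Lipschitz constant
  -- there gives uniqueness on common intervals.
  choose X hX0 hX using fun n : ℕ => exists_hasDerivWithinAt_Icc_of_lyapunov hf hV hdec hρ
    (show t₀ ≤ t₀ + n by simp)
  have huniq : ∀ m n : ℕ, m ≤ n → ∀ t ∈ Icc t₀ (t₀ + m), X m t = X n t := by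
    intro m n hmn
    have hmn' : (m : ℝ) ≤ n := by exact_mod_cast hmn
    have hsub : Icc t₀ (t₀ + m) ⊆ Icc t₀ (t₀ + n) := Icc_subset_Icc_right (by linarith)
    obtain ⟨K, hK⟩ := LocallyLipschitzOn.exists_lipschitzOnWith_of_compact
      (isCompact_Icc.prod (isCompact_closedBall (0 : E) ρ) (s := Icc t₀ (t₀ + m)))
      hf.locallyLipschitzOn
    have hder : ∀ k : ℕ, m ≤ k → ∀ t ∈ Ico t₀ (t₀ + m),
        HasDerivWithinAt (X k) (f (t, X k t)) (Ici t) t := by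
      intro k hk t ht
      have hk' : (m : ℝ) ≤ k := by exact_mod_cast hk
      have h := (hX k t ⟨ht.1, by linarith [ht.2]⟩).1
      refine (h.mono_of_mem_nhdsWithin ?_)
      exact mem_of_superset (Icc_mem_nhdsGE (show t < t₀ + k by linarith [ht.2]))
        (Icc_subset_Icc_left ht.1)
    have hcont : ∀ k : ℕ, m ≤ k → ContinuousOn (X k) (Icc t₀ (t₀ + m)) := by
      intro k hk t ht
      have hk' : (m : ℝ) ≤ k := by exact_mod_cast hk
      have hs : Icc t₀ (t₀ + m) ⊆ Icc t₀ (t₀ + k) := Icc_subset_Icc_right (by linarith)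
      exact ((hX k t (hs ht)).1.continuousWithinAt).mono hs
    refine ODE_solution_unique_of_mem_Icc_right (v := fun t x => f (t, x))
      (s := fun _ => Metric.closedBall 0 ρ) (K := K) ?_ (hcont m le_rfl) (hder m le_rfl) ?_
      (hcont n hmn) (hder n hmn) ?_ (by rw [hX0, hX0])
    · intro t ht
      refine LipschitzOnWith.of_dist_le_mul fun x hx y hy => ?_
      have := hK.dist_le_mul (t, x) ⟨Ico_subset_Icc_self ht, hx⟩ (t, y)
        ⟨Ico_subset_Icc_self ht, hy⟩
      simpa [Prod.dist_eq] using this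
    · intro t ht
      simpa using (hX m t (Ico_subset_Icc_self ht)).2
    · intro t ht
      simpa using (hX n t (hsub (Ico_subset_Icc_self ht))).2
  have huniq' : ∀ m n : ℕ, ∀ t ∈ Icc t₀ (t₀ + m), t ∈ Icc t₀ (t₀ + n) → X m t = X n t := by
    intro m n t hm hn
    rcases le_total m n with h | h
    · exact huniq m n h t hm
    · exact (huniq n m h t hn).symm
  have hmem : ∀ t, t₀ ≤ t → t < t₀ + ((⌈t - t₀⌉₊ + 1 : ℕ) : ℝ) := by
    intro t _
    have := Nat.le_ceil (t - t₀)
    push_cast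
    linarith
  -- The `+ 1` keeps `t` strictly before the right end of the interval, so a derivative within that
  -- interval is one within `Ici t₀`.
  refine ⟨fun t => X (⌈t - t₀⌉₊ + 1) t, hX0 _, fun t ht => ?_⟩
  set n := ⌈t - t₀⌉₊ + 1 with hn
  have htn : t < t₀ + n := hmem t ht
  have h := (hX n t ⟨ht, htn.le⟩).1
  have h2 : HasDerivWithinAt (fun t => X (⌈t - t₀⌉₊ + 1) t) (f (t, X n t)) (Icc t₀ (t₀ + n)) t :=
    h.congr (fun s hs => huniq' _ _ s ⟨hs.1, (hmem s hs.1).le⟩ hs) rfl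
  refine h2.mono_of_mem_nhdsWithin ?_
  rw [← Ici_inter_Iic]
  exact inter_mem self_mem_nhdsWithin (mem_nhdsWithin_of_mem_nhds (Iic_mem_nhds htn))

end GlobalExistence

end General

/-! ### Nonlinear gains and their potentials -/

namespace AUV

namespace Gain

variable {G : Gain} {j : Fin 3}

/-- The two branches are one power of a base bounded away from zero, which makes positivity,
monotonicity and Lipschitz regularity immediate. -/
theorem k_eq (G : Gain) (j : Fin 3) (e : ℝ) :
    G.k j e = G.a j * max |e| (G.b j) ^ (G.μ j - 1) := by
  unfold k
  split_ifs with h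
  · rw [max_eq_left h]
  · rw [max_eq_right (le_of_not_ge h)]

theorem max_abs_pos (hG : G.Admissible) (j : Fin 3) (e : ℝ) : 0 < max |e| (G.b j) :=
  lt_max_of_lt_right (hG j).2.1

theorem k_pos (hG : G.Admissible) (j : Fin 3) (e : ℝ) : 0 < G.k j e := by
  rw [k_eq]
  exact mul_pos (hG j).1 (Real.rpow_pos_of_pos (max_abs_pos hG j e) _)

/-- The exponent `μ - 1` is nonpositive. -/
theorem k_anti (hG : G.Admissible) {x y : ℝ} (h : |x| ≤ |y|) : G.k j y ≤ G.k j x := by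
  rw [k_eq, k_eq]
  exact mul_le_mul_of_nonneg_left (Real.rpow_le_rpow_of_nonpos (max_abs_pos hG j x)
    (max_le_max_right _ h) (by linarith [(hG j).2.2.2])) (hG j).1.le

theorem k_neg (G : Gain) (j : Fin 3) (x : ℝ) : G.k j (-x) = G.k j x := by simp [k]

theorem K_posDef (hG : G.Admissible) (e : Vec3) : (G.K e).PosDef :=
  Matrix.PosDef.diagonal fun j => k_pos hG j (e j)

theorem locallyLipschitz_k (hG : G.Admissible) (j : Fin 3) : LocallyLipschitz (G.k j) := by
  have h1 : LocallyLipschitz fun e : ℝ => max |e| (G.b j) :=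
    (lipschitzWith_one_norm (E := ℝ)).locallyLipschitz.max_const _
  have h2 : LocallyLipschitz fun e : ℝ => max |e| (G.b j) ^ (G.μ j - 1) :=
    h1.comp_contDiffAt (g := fun y => y ^ (G.μ j - 1)) fun x =>
      Real.contDiffAt_rpow_const_of_ne (max_abs_pos hG j x).ne'
  have h3 := (LocallyLipschitz.const (G.a j)).mul_real h2
  rwa [show G.k j = fun e => G.a j * max |e| (G.b j) ^ (G.μ j - 1) from funext (k_eq G j)]

/-- Potential of the restoring force `e ↦ k e * e` of the `j`-th channel. -/
noncomputable def potential (G : Gain) (j : Fin 3) (x : ℝ) : ℝ := ∫ s in (0 : ℝ)..x, G.k j s * s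

theorem hasDerivAt_potential (hG : G.Admissible) (j : Fin 3) (x : ℝ) :
    HasDerivAt (G.potential j) (G.k j x * x) x := by
  have hc : Continuous fun s => G.k j s * s :=
    (locallyLipschitz_k hG j).continuous.mul continuous_id
  exact intervalIntegral.integral_hasDerivAt_right (hc.intervalIntegrable _ _)
    (hc.stronglyMeasurableAtFilter _ _) hc.continuousAt

theorem locallyLipschitz_potential (hG : G.Admissible) (j : Fin 3) :
    LocallyLipschitz (G.potential j) := by
  have hc : Continuous fun s => G.k j s * s :=
    (locallyLipschitz_k hG j).continuous.mul continuous_id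
  refine ContDiff.locallyLipschitz (𝕂 := ℝ) (contDiff_one_iff_deriv.2
    ⟨fun x => (hasDerivAt_potential hG j x).differentiableAt, ?_⟩)
  rwa [show deriv (G.potential j) = fun s => G.k j s * s from
    funext fun x => (hasDerivAt_potential hG j x).deriv]

theorem potential_zero (G : Gain) (j : Fin 3) : G.potential j 0 = 0 := by simp [potential]

theorem potential_abs (G : Gain) (j : Fin 3) (x : ℝ) : G.potential j |x| = G.potential j x := by
  rcases abs_choice x with h | h
  · rw [h]
  · rw [h, potential, potential]
    have := intervalIntegral.integral_comp_neg (a := 0) (b := x) fun s => G.k j s * s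
    rw [neg_zero] at this
    rw [intervalIntegral.integral_symm, ← this, ← intervalIntegral.integral_neg]
    exact intervalIntegral.integral_congr fun s _ => by simp only [k_neg]; ring

/-- On `[0, |x|]` the gain is least at the far end, so it may be frozen there and the remaining
linear force integrated. -/
theorem potential_ge (hG : G.Admissible) (j : Fin 3) (x : ℝ) :
    G.k j x * x ^ 2 / 2 ≤ G.potential j x := by
  have hc : Continuous fun s => G.k j s * s :=
    (locallyLipschitz_k hG j).continuous.mul continuous_id
  have hc' : Continuous fun s => G.k j x * s := by fun_prop
  have := intervalIntegral.integral_mono_on (μ := volume) (abs_nonneg x) (hc'.intervalIntegrable 0 |x|)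
    (hc.intervalIntegrable 0 |x|) fun s hs => mul_le_mul_of_nonneg_right
      (k_anti hG (by rw [abs_of_nonneg hs.1]; exact hs.2)) hs.1
  rw [intervalIntegral.integral_const_mul, integral_id] at this
  rw [← potential_abs]
  refine le_trans (le_of_eq ?_) this
  simp
  ring

theorem potential_le (hG : G.Admissible) (j : Fin 3) (x : ℝ) :
    G.potential j x ≤ G.k j 0 * x ^ 2 / 2 := by
  have hc : Continuous fun s => G.k j s * s :=
    (locallyLipschitz_k hG j).continuous.mul continuous_id
  have hc' : Continuous fun s => G.k j 0 * s := by fun_prop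
  have := intervalIntegral.integral_mono_on (μ := volume) (abs_nonneg x) (hc.intervalIntegrable 0 |x|)
    (hc'.intervalIntegrable 0 |x|) fun s hs => mul_le_mul_of_nonneg_right
      (k_anti hG (by simp)) hs.1
  rw [intervalIntegral.integral_const_mul, integral_id] at this
  rw [← potential_abs]
  refine this.trans (le_of_eq ?_)
  simp
  ring

theorem potential_nonneg (hG : G.Admissible) (j : Fin 3) (x : ℝ) : 0 ≤ G.potential j x :=
  le_trans (by have := k_pos hG j x; positivity) (potential_ge hG j x)

/-- The potential is proper. -/
theorem abs_le_of_potential_le (hG : G.Admissible) {x c : ℝ} (h : G.potential j x ≤ c) :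
    |x| ≤ max (G.b j) (2 * c / (G.a j * G.b j ^ G.μ j)) := by
  obtain ⟨ha, hb, hμ⟩ := hG j
  by_contra! hlt
  obtain ⟨h1, h2⟩ := max_lt_iff.1 hlt
  have hx : 0 < |x| := hb.trans h1
  have h3 := (potential_ge hG j x).trans h
  -- Beyond `b` the bound from `potential_ge` is `a |x| ^ (μ + 1) / 2`; as `μ ≥ 0`, it grows at
  -- least linearly, with slope `a * b ^ μ / 2`.
  have hk : G.k j x * x ^ 2 = G.a j * |x| ^ G.μ j * |x| := by
    rw [k_eq, max_eq_left h1.le, Real.rpow_sub_one hx.ne', ← sq_abs x]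
    field_simp
  have h4 : G.b j ^ G.μ j ≤ |x| ^ G.μ j := Real.rpow_le_rpow hb.le h1.le hμ.1
  have hbp : 0 < G.b j ^ G.μ j := Real.rpow_pos_of_pos hb _
  rw [div_lt_iff₀ (by positivity)] at h2
  have h5 : G.a j * G.b j ^ G.μ j * |x| ≤ G.a j * |x| ^ G.μ j * |x| := by gcongr
  rw [hk] at h3
  linarith

end Gain

end AUV

/-! ### Error system in the body frame, energy and cross term -/

namespace AUV

theorem dotProduct_mulVec_eq_sum (v : Vec3) (A : Mat3) (w : Vec3) :
    v ⬝ᵥ A *ᵥ w = ∑ i, v i * ∑ j, A i j * w j := rfl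

theorem R_transpose_mul (θ : ℝ) : (R θ)ᵀ * R θ = 1 := by
  have h := Real.sin_sq_add_cos_sq θ
  ext i j
  fin_cases i <;> fin_cases j <;>
    simp [R, Matrix.mul_apply, Fin.sum_univ_three] <;> nlinarith

theorem R_mul_transpose (θ : ℝ) : R θ * (R θ)ᵀ = 1 :=
  mul_eq_one_comm.1 (R_transpose_mul θ)

theorem R_inv (θ : ℝ) : (R θ)⁻¹ = (R θ)ᵀ := Matrix.inv_eq_left_inv (R_transpose_mul θ)

theorem R_transpose_mulVec_mulVec (θ : ℝ) (v : Vec3) : (R θ)ᵀ *ᵥ R θ *ᵥ v = v := by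
  rw [Matrix.mulVec_mulVec, R_transpose_mul, Matrix.one_mulVec]

theorem R_mulVec_transpose_mulVec (θ : ℝ) (v : Vec3) : R θ *ᵥ (R θ)ᵀ *ᵥ v = v := by
  rw [Matrix.mulVec_mulVec, R_mul_transpose, Matrix.one_mulVec]

theorem dotProduct_R_transpose_mulVec (θ : ℝ) (v w : Vec3) :
    v ⬝ᵥ (R θ)ᵀ *ᵥ w = (R θ *ᵥ v) ⬝ᵥ w := by
  rw [Matrix.dotProduct_mulVec, Matrix.vecMul_transpose]

theorem R_mulVec_dotProduct_R_mulVec (θ : ℝ) (v w : Vec3) :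
    (R θ *ᵥ v) ⬝ᵥ (R θ *ᵥ w) = v ⬝ᵥ w := by
  rw [← dotProduct_R_transpose_mulVec, R_transpose_mulVec_mulVec]

/-- Differentiating `R Rᵀ = 1` gives `Ṙ Rᵀ = -R Ṙᵀ`. -/
theorem R_transpose_mul_Rdot_mul_R_transpose (θ r : ℝ) :
    (R θ)ᵀ * Rdot θ r * (R θ)ᵀ = -(Rdot θ r)ᵀ := by
  have h : Rdot θ r * (R θ)ᵀ = -(R θ * (Rdot θ r)ᵀ) := by
    ext i j
    simp only [Matrix.neg_apply, Matrix.mul_apply, Matrix.transpose_apply, Fin.sum_univ_three]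
    fin_cases i <;> fin_cases j <;> simp [R, Rdot] <;> ring
  rw [mul_assoc, h, mul_neg, ← mul_assoc, R_transpose_mul, one_mul]

namespace Params

/-- Diagonal of the inertia matrix. -/
def mass (P : Params) : Vec3 := ![P.m11, P.m22, P.m33]

/-- Diagonal of the damping matrix. -/
def damping (P : Params) (ν : Vec3) : Vec3 :=
  ![-P.Xu - P.Xuu * |ν 0|, -P.Yv - P.Yvv * |ν 1|, -P.Nr - P.Nrr * |ν 2|]

theorem M_eq (P : Params) : P.M = Matrix.diagonal P.mass := rfl

theorem D_eq (P : Params) (ν : Vec3) : P.D ν = Matrix.diagonal (P.damping ν) := rfl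

theorem M_mulVec_apply (P : Params) (v : Vec3) (j : Fin 3) : (P.M *ᵥ v) j = P.mass j * v j :=
  Matrix.mulVec_diagonal _ _ _

theorem mass_pos {P : Params} (hM : P.M.PosDef) (j : Fin 3) : 0 < P.mass j :=
  Matrix.posDef_diagonal_iff.1 hM j

/-- `C(ν)` is skew-symmetric: Coriolis forces do no work. -/
theorem dotProduct_C_mulVec (P : Params) (ν z : Vec3) : z ⬝ᵥ P.C ν *ᵥ z = 0 := by
  simp [C, Matrix.mulVec, dotProduct, Fin.sum_univ_three]
  ring

/-- A positive `b` would destroy positivity at `x = |a| / b`, so the quadratic term can only add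
damping. -/
theorem le_neg_sub_mul_abs {a b : ℝ} (h : ∀ x : ℝ, 0 < -a - b * |x|) (x : ℝ) :
    -a ≤ -a - b * |x| := by
  by_contra! hlt
  have hb : 0 < b := by
    by_contra! hb
    nlinarith [abs_nonneg x]
  have h1 := h (|a| / b)
  rw [abs_of_nonneg (by positivity), mul_div_cancel₀ _ hb.ne'] at h1
  linarith [neg_abs_le a]

/-- A damping matrix that is positive definite at every velocity is uniformly so. -/
theorem exists_damping_ge {P : Params} (hD : ∀ ν : Vec3, (P.D ν).PosDef) :
    ∃ c > 0, ∀ ν j, c ≤ P.damping ν j := by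
  have h : ∀ ν j, 0 < P.damping ν j := fun ν => Matrix.posDef_diagonal_iff.1 (hD ν)
  -- Each entry depends on a single velocity component, so velocities along the axes suffice as
  -- tests; damping is least at rest.
  have hle : ∀ ν j, P.damping 0 j ≤ P.damping ν j := by
    intro ν j
    fin_cases j
    · have := le_neg_sub_mul_abs (fun x => h ![x, 0, 0] 0) (ν 0)
      simpa [damping] using this
    · have := le_neg_sub_mul_abs (fun x => h ![0, x, 0] 1) (ν 1)
      simpa [damping] using this
    · have := le_neg_sub_mul_abs (fun x => h ![0, 0, x] 2) (ν 2)
      simpa [damping] using this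
  obtain ⟨i, hi⟩ := Finite.exists_min (P.damping 0)
  exact ⟨P.damping 0 i, h 0 i, fun ν j => (hi j).trans (hle ν j)⟩

end Params

/-- Velocity error in the body frame. -/
noncomputable def bodyErr (ref : ℝ → Vec3) (t : ℝ) (η ν : Vec3) : Vec3 :=
  (R (η 2))ᵀ *ᵥ deriv ref t - ν

theorem velErr_eq (ref : ℝ → Vec3) (t : ℝ) (η ν : Vec3) :
    velErr ref t η ν = R (η 2) *ᵥ bodyErr ref t η ν := by
  rw [bodyErr, Matrix.mulVec_sub, R_mulVec_transpose_mulVec, velErr]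

theorem bodyErr_eq (ref : ℝ → Vec3) (t : ℝ) (η ν : Vec3) :
    bodyErr ref t η ν = (R (η 2))ᵀ *ᵥ velErr ref t η ν := by
  rw [velErr_eq, R_transpose_mulVec_mulVec]

/-- Feedback force in the body frame, at the yaw angle `θ`, the position error `e` and the
body-frame velocity error `z`. -/
noncomputable def feedback (Gp Gv : Gain) (θ : ℝ) (e z : Vec3) : Vec3 :=
  (R θ)ᵀ *ᵥ (Gp.K e *ᵥ e + Gv.K (R θ *ᵥ z) *ᵥ (R θ *ᵥ z))

/-- The rotations cancel, and the `Ṙ` part of `earthC` becomes `M Ṙᵀ η̇_ref`. Together with `M Rᵀ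
η̈_ref` it is `M` applied to the derivative of `Rᵀ η̇_ref`, as the equation for `z` requires. -/
theorem control_eq (P : Params) (Gp Gv : Gain) (ref : ℝ → Vec3) (t : ℝ) (η ν : Vec3) :
    control P Gp Gv ref t η ν =
      P.M *ᵥ (R (η 2))ᵀ *ᵥ deriv (deriv ref) t + P.C ν *ᵥ (R (η 2))ᵀ *ᵥ deriv ref t
        + P.M *ᵥ (Rdot (η 2) (ν 2))ᵀ *ᵥ deriv ref t + P.D ν *ᵥ (R (η 2))ᵀ *ᵥ deriv ref t
        + feedback Gp Gv (η 2) (posErr ref t η) (bodyErr ref t η ν) := by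
  have hC : (P.C ν - P.M * (R (η 2))ᵀ * Rdot (η 2) (ν 2)) * (R (η 2))ᵀ
      = P.C ν * (R (η 2))ᵀ + P.M * (Rdot (η 2) (ν 2))ᵀ := by
    rw [sub_mul, mul_assoc P.M, mul_assoc P.M, R_transpose_mul_Rdot_mul_R_transpose, mul_neg,
      sub_neg_eq_add]
  rw [control, feedback, ← velErr_eq, earthM, earthC, earthD, R_inv, Matrix.transpose_transpose,
    mul_assoc _ _ (R (η 2))ᵀ, mul_assoc _ _ (R (η 2))ᵀ, mul_assoc _ _ (R (η 2))ᵀ, hC]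
  simp only [Matrix.mulVec_add, ← Matrix.mulVec_mulVec, R_transpose_mulVec_mulVec,
    Matrix.add_mulVec]
  abel

/-- The vehicle equation under the tracking law, in terms of the tracking errors. -/
theorem dynamics_iff (P : Params) (Gp Gv : Gain) (ref : ℝ → Vec3) (t : ℝ) (η ν ν' w : Vec3) :
    P.M *ᵥ ν' + P.C ν *ᵥ ν + P.D ν *ᵥ ν = control P Gp Gv ref t η ν + w ↔
      P.M *ᵥ ((Rdot (η 2) (ν 2))ᵀ *ᵥ deriv ref t + (R (η 2))ᵀ *ᵥ deriv (deriv ref) t - ν')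
        + P.C ν *ᵥ bodyErr ref t η ν + P.D ν *ᵥ bodyErr ref t η ν
        + feedback Gp Gv (η 2) (posErr ref t η) (bodyErr ref t η ν) + w = 0 := by
  rw [control_eq, ← sub_eq_zero, ← neg_eq_zero]
  refine Eq.congr ?_ rfl
  simp only [bodyErr, Matrix.mulVec_add, Matrix.mulVec_sub]
  abel

theorem hasDerivAt_R_transpose_mulVec {θ : ℝ → ℝ} {r t : ℝ} {v : ℝ → Vec3} {v' : Vec3}
    (hθ : HasDerivAt θ r t) (hv : HasDerivAt v v' t) :
    HasDerivAt (fun s => (R (θ s))ᵀ *ᵥ v s) ((Rdot (θ t) r)ᵀ *ᵥ v t + (R (θ t))ᵀ *ᵥ v') t := by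
  rw [hasDerivAt_pi]
  intro i
  have h := HasDerivAt.fun_sum (u := Finset.univ) fun j _ =>
    (hasDerivAt_R_apply hθ j i).fun_mul (hasDerivAt_pi.1 hv j)
  refine h.congr_deriv ?_
  simp [Matrix.mulVec, dotProduct, Finset.sum_add_distrib]

/-- Total energy of the error system. -/
noncomputable def energy (P : Params) (Gp : Gain) (e z : Vec3) : ℝ :=
  ∑ j, (P.mass j * z j ^ 2 / 2 + Gp.potential j (e j))

/-- Cross term of position error and momentum. -/
noncomputable def crossTerm (P : Params) (θ : ℝ) (e z : Vec3) : ℝ := e ⬝ᵥ R θ *ᵥ P.M *ᵥ z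

theorem hasDerivAt_energy (P : Params) {Gp : Gain} (hGp : Gp.Admissible) {e z : ℝ → Vec3}
    {e' z' : Vec3} {t : ℝ} (he : HasDerivAt e e' t) (hz : HasDerivAt z z' t) :
    HasDerivAt (fun s => energy P Gp (e s) (z s))
      (z t ⬝ᵥ P.M *ᵥ z' + e' ⬝ᵥ Gp.K (e t) *ᵥ e t) t := by
  have h := HasDerivAt.fun_sum (u := Finset.univ) fun j _ =>
    ((((hasDerivAt_pi.1 hz j).fun_pow 2).const_mul (P.mass j)).div_const 2).add
      ((Gain.hasDerivAt_potential hGp j (e t j)).comp t (hasDerivAt_pi.1 he j))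
  refine h.congr_deriv ?_
  simp only [P.M_eq, Gain.K, dotProduct, Matrix.mulVec_diagonal, ← Finset.sum_add_distrib]
  refine Finset.sum_congr rfl fun j _ => ?_
  simp
  ring

theorem hasDerivAt_crossTerm (P : Params) {θ : ℝ → ℝ} {e z : ℝ → Vec3} {r : ℝ}
    {e' z' : Vec3} {t : ℝ} (hθ : HasDerivAt θ r t) (he : HasDerivAt e e' t)
    (hz : HasDerivAt z z' t) :
    HasDerivAt (fun s => crossTerm P (θ s) (e s) (z s))
      (e' ⬝ᵥ R (θ t) *ᵥ P.M *ᵥ z t + e t ⬝ᵥ Rdot (θ t) r *ᵥ P.M *ᵥ z t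
        + e t ⬝ᵥ R (θ t) *ᵥ P.M *ᵥ z') t := by
  have h := HasDerivAt.fun_sum (u := Finset.univ) fun i _ => (hasDerivAt_pi.1 he i).fun_mul
    (HasDerivAt.fun_sum (u := Finset.univ) fun j _ => (hasDerivAt_R_apply hθ i j).fun_mul
      ((hasDerivAt_pi.1 hz j).const_mul (P.mass j)))
  have h2 : (fun s => crossTerm P (θ s) (e s) (z s)) =
      fun s => ∑ i, e s i * ∑ j, R (θ s) i j * (P.mass j * z s j) := by
    funext s
    simp only [crossTerm, dotProduct_mulVec_eq_sum, P.M_mulVec_apply]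
  rw [h2]
  refine h.congr_deriv ?_
  simp only [dotProduct_mulVec_eq_sum, P.M_mulVec_apply, Fin.sum_univ_three]
  ring

/-- Dissipation of the energy along the error system. -/
theorem energy_rate {P : Params} {Gp Gv : Gain} {θ : ℝ} {ν e z z' w : Vec3}
    (h : P.M *ᵥ z' + P.C ν *ᵥ z + P.D ν *ᵥ z + feedback Gp Gv θ e z + w = 0) :
    z ⬝ᵥ P.M *ᵥ z' + (R θ *ᵥ z) ⬝ᵥ Gp.K e *ᵥ e =
      -(z ⬝ᵥ P.D ν *ᵥ z) - (R θ *ᵥ z) ⬝ᵥ Gv.K (R θ *ᵥ z) *ᵥ (R θ *ᵥ z) - z ⬝ᵥ w := by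
  -- Pairing the error equation with `z` removes the Coriolis term and produces the `K_p` work that
  -- cancels the rate of the potential.
  have h1 := congrArg (fun v => z ⬝ᵥ v) h
  simp only [dotProduct_add, Params.dotProduct_C_mulVec, feedback, dotProduct_zero,
    dotProduct_R_transpose_mulVec] at h1
  linarith

/-- Rate of the cross term along the undisturbed error system. -/
theorem crossTerm_rate {P : Params} {Gp Gv : Gain} {θ r : ℝ} {ν e z z' : Vec3}
    (h : P.M *ᵥ z' + P.C ν *ᵥ z + P.D ν *ᵥ z + feedback Gp Gv θ e z = 0) :
    (R θ *ᵥ z) ⬝ᵥ R θ *ᵥ P.M *ᵥ z + e ⬝ᵥ Rdot θ r *ᵥ P.M *ᵥ z + e ⬝ᵥ R θ *ᵥ P.M *ᵥ z' =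
      z ⬝ᵥ P.M *ᵥ z - e ⬝ᵥ Gp.K e *ᵥ e
        + e ⬝ᵥ (Rdot θ r * P.M - R θ * P.C ν - R θ * P.D ν - Gv.K (R θ *ᵥ z) * R θ) *ᵥ z := by
  -- Substituting for `M z'` brings in `-e ⬝ K_p e`, the dissipation in `e` that the energy lacks.
  have h1 : P.M *ᵥ z' = -(P.C ν *ᵥ z + P.D ν *ᵥ z + feedback Gp Gv θ e z) := by
    rw [eq_neg_iff_add_eq_zero, ← h]
    abel
  rw [h1, R_mulVec_dotProduct_R_mulVec]
  simp only [feedback, Matrix.mulVec_neg, Matrix.mulVec_add, R_mulVec_transpose_mulVec,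
    Matrix.sub_mulVec, ← Matrix.mulVec_mulVec, dotProduct_add, dotProduct_neg, dotProduct_sub]
  ring

end AUV

/-! ### Quadratic bounds and the strict Lyapunov function -/

namespace AUV

theorem dotProduct_self_nonneg (v : Vec3) : 0 ≤ v ⬝ᵥ v :=
  Finset.sum_nonneg fun i _ => mul_self_nonneg (v i)

theorem norm_sq_le_dotProduct_self (v : Vec3) : ‖v‖ ^ 2 ≤ v ⬝ᵥ v := by
  have h : ‖v‖ ≤ √(v ⬝ᵥ v) := by
    refine (pi_norm_le_iff_of_nonneg (Real.sqrt_nonneg _)).2 fun i => ?_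
    rw [Real.norm_eq_abs]
    refine Real.abs_le_sqrt ?_
    rw [sq]
    exact Finset.single_le_sum (f := fun j => v j * v j) (fun j _ => mul_self_nonneg (v j))
      (Finset.mem_univ i)
  exact (Real.le_sqrt (norm_nonneg v) (dotProduct_self_nonneg v)).1 h

theorem dotProduct_self_le (v : Vec3) : v ⬝ᵥ v ≤ 3 * ‖v‖ ^ 2 := by
  have h : ∀ i, v i * v i ≤ ‖v‖ ^ 2 := fun i => by
    rw [← sq, ← sq_abs]
    exact pow_le_pow_left₀ (abs_nonneg _) (norm_le_pi_norm v i) 2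
  calc v ⬝ᵥ v ≤ ∑ _i : Fin 3, ‖v‖ ^ 2 := Finset.sum_le_sum fun i _ => h i
    _ = 3 * ‖v‖ ^ 2 := by simp

theorem dotProduct_sq_le (v w : Vec3) : (v ⬝ᵥ w) ^ 2 ≤ (v ⬝ᵥ v) * (w ⬝ᵥ w) := by
  have := Finset.sum_mul_sq_le_sq_mul_sq Finset.univ v w
  simpa only [dotProduct, ← sq] using this

theorem dotProduct_mulVec_sq_le {A : Mat3} {q : ℝ} (hA : ∀ i j, |A i j| ≤ q) (v w : Vec3) :
    (v ⬝ᵥ A *ᵥ w) ^ 2 ≤ 9 * q ^ 2 * ((v ⬝ᵥ v) * (w ⬝ᵥ w)) := by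
  have h1 : ∀ i, (A *ᵥ w) i * (A *ᵥ w) i ≤ 3 * q ^ 2 * (w ⬝ᵥ w) := by
    intro i
    have h2 := dotProduct_sq_le (A i) w
    have h3 : A i ⬝ᵥ A i ≤ 3 * q ^ 2 := by
      calc A i ⬝ᵥ A i ≤ ∑ _j : Fin 3, q ^ 2 := Finset.sum_le_sum fun j _ => by
            rw [← sq, ← sq_abs]
            exact pow_le_pow_left₀ (abs_nonneg _) (hA i j) 2
        _ = 3 * q ^ 2 := by simp
    calc (A *ᵥ w) i * (A *ᵥ w) i = (A i ⬝ᵥ w) ^ 2 := (sq _).symm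
      _ ≤ (A i ⬝ᵥ A i) * (w ⬝ᵥ w) := h2
      _ ≤ _ := mul_le_mul_of_nonneg_right h3 (dotProduct_self_nonneg w)
  have h4 : (A *ᵥ w) ⬝ᵥ (A *ᵥ w) ≤ 9 * q ^ 2 * (w ⬝ᵥ w) := by
    calc (A *ᵥ w) ⬝ᵥ (A *ᵥ w) ≤ ∑ _i : Fin 3, 3 * q ^ 2 * (w ⬝ᵥ w) :=
          Finset.sum_le_sum fun i _ => h1 i
      _ = _ := by simp; ring
  calc (v ⬝ᵥ A *ᵥ w) ^ 2 ≤ (v ⬝ᵥ v) * ((A *ᵥ w) ⬝ᵥ (A *ᵥ w)) := dotProduct_sq_le _ _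
    _ ≤ (v ⬝ᵥ v) * (9 * q ^ 2 * (w ⬝ᵥ w)) :=
        mul_le_mul_of_nonneg_left h4 (dotProduct_self_nonneg v)
    _ = _ := by ring

theorem diagonal_quadratic (d v : Vec3) :
    v ⬝ᵥ Matrix.diagonal d *ᵥ v = ∑ j, d j * (v j * v j) := by
  simp only [dotProduct, Matrix.mulVec_diagonal]
  exact Finset.sum_congr rfl fun j _ => by ring

theorem le_diagonal_quadratic {d : Vec3} {c : ℝ} (h : ∀ j, c ≤ d j) (v : Vec3) :
    c * (v ⬝ᵥ v) ≤ v ⬝ᵥ Matrix.diagonal d *ᵥ v := by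
  rw [diagonal_quadratic, dotProduct, Finset.mul_sum]
  exact Finset.sum_le_sum fun j _ => mul_le_mul_of_nonneg_right (h j) (mul_self_nonneg _)

theorem diagonal_quadratic_le {d : Vec3} {c : ℝ} (h : ∀ j, d j ≤ c) (v : Vec3) :
    v ⬝ᵥ Matrix.diagonal d *ᵥ v ≤ c * (v ⬝ᵥ v) := by
  rw [diagonal_quadratic, dotProduct, Finset.mul_sum]
  exact Finset.sum_le_sum fun j _ => mul_le_mul_of_nonneg_right (h j) (mul_self_nonneg _)

theorem K_quadratic_nonneg {G : Gain} (hG : G.Admissible) (e v : Vec3) :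
    0 ≤ v ⬝ᵥ G.K e *ᵥ v := by
  have := le_diagonal_quadratic (c := 0) (fun j => (Gain.k_pos hG j (e j)).le) v
  rwa [zero_mul] at this

/-- When `μ < 1` the gain tends to zero at infinity, so a positive lower bound needs bounded errors;
monotonicity puts the minimum at `ρ`. -/
theorem exists_forall_k_ge {G : Gain} (hG : G.Admissible) (ρ : ℝ) :
    ∃ c > 0, ∀ j x, |x| ≤ ρ → c ≤ G.k j x := by
  obtain ⟨i, hi⟩ := Finite.exists_min fun j => G.k j ρ
  refine ⟨G.k i ρ, Gain.k_pos hG i ρ, fun j x hx => (hi j).trans ?_⟩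
  exact Gain.k_anti hG (hx.trans (le_abs_self ρ))

section Energy

variable {P : Params} {Gp Gv : Gain}

theorem energy_nonneg (hM : P.M.PosDef) (hGp : Gp.Admissible) (e z : Vec3) :
    0 ≤ energy P Gp e z :=
  Finset.sum_nonneg fun j _ => add_nonneg
    (by have := P.mass_pos hM j; positivity) (Gain.potential_nonneg hGp j _)

theorem energy_zero (P : Params) (Gp : Gain) : energy P Gp 0 0 = 0 := by
  simp [energy, Gain.potential_zero]

theorem exists_energy_ge (hM : P.M.PosDef) (hGp : Gp.Admissible) (ρ : ℝ) :
    ∃ l > 0, ∀ e : Vec3, ‖e‖ ≤ ρ → l * (e ⬝ᵥ e) ≤ e ⬝ᵥ Gp.K e *ᵥ e ∧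
      ∀ z, l * (e ⬝ᵥ e + z ⬝ᵥ z) ≤ energy P Gp e z := by
  obtain ⟨c, hc, hk⟩ := exists_forall_k_ge hGp ρ
  obtain ⟨i, hi⟩ := Finite.exists_min P.mass
  have hm := P.mass_pos hM i
  have hl1 : min (c / 2) (P.mass i / 2) ≤ c / 2 := min_le_left _ _
  have hl2 : min (c / 2) (P.mass i / 2) ≤ P.mass i / 2 := min_le_right _ _
  refine ⟨min (c / 2) (P.mass i / 2), by positivity, fun e he => ?_⟩
  have hke : ∀ j, c ≤ Gp.k j (e j) := fun j => hk j _ ((norm_le_pi_norm e j).trans he)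
  refine ⟨le_diagonal_quadratic (fun j => ?_) e, fun z => ?_⟩
  · linarith [hke j]
  · rw [dotProduct, dotProduct, ← Finset.sum_add_distrib, Finset.mul_sum]
    refine Finset.sum_le_sum fun j _ => ?_
    have h1 := Gain.potential_ge hGp j (e j)
    have h2 : min (c / 2) (P.mass i / 2) * (e j * e j) ≤ Gp.k j (e j) / 2 * (e j * e j) :=
      mul_le_mul_of_nonneg_right (by linarith [hke j]) (mul_self_nonneg _)
    have h3 : min (c / 2) (P.mass i / 2) * (z j * z j) ≤ P.mass j / 2 * (z j * z j) :=
      mul_le_mul_of_nonneg_right (by linarith [hi j]) (mul_self_nonneg _)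
    nlinarith

/-- Gains are largest at zero error, so unlike the lower bound this one is global. -/
theorem exists_energy_le (P : Params) (hGp : Gp.Admissible) :
    ∃ u > 0, (∀ z : Vec3, z ⬝ᵥ P.M *ᵥ z ≤ u * (z ⬝ᵥ z)) ∧
      ∀ e z, energy P Gp e z ≤ u * (e ⬝ᵥ e + z ⬝ᵥ z) := by
  obtain ⟨i, hi⟩ := Finite.exists_max P.mass
  obtain ⟨n, hn⟩ := Finite.exists_max fun j => Gp.k j 0
  have hk := Gain.k_pos hGp n 0
  have hu1 := le_max_left (P.mass i) (Gp.k n 0)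
  have hu2 := le_max_right (P.mass i) (Gp.k n 0)
  have hu : 0 < max (P.mass i) (Gp.k n 0) := lt_max_of_lt_right hk
  refine ⟨max (P.mass i) (Gp.k n 0), hu, diagonal_quadratic_le fun j => (hi j).trans hu1,
    fun e z => ?_⟩
  rw [dotProduct, dotProduct, ← Finset.sum_add_distrib, Finset.mul_sum]
  refine Finset.sum_le_sum fun j _ => ?_
  have h1 := Gain.potential_le hGp j (e j)
  have h2 : Gp.k j 0 / 2 * (e j * e j) ≤ max (P.mass i) (Gp.k n 0) * (e j * e j) :=
    mul_le_mul_of_nonneg_right (by linarith [hn j]) (mul_self_nonneg _)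
  have h3 : P.mass j / 2 * (z j * z j) ≤ max (P.mass i) (Gp.k n 0) * (z j * z j) :=
    mul_le_mul_of_nonneg_right (by linarith [hi j]) (mul_self_nonneg _)
  nlinarith

/-- The energy is proper. -/
theorem exists_norm_le_of_energy_le (hM : P.M.PosDef) (hGp : Gp.Admissible) (c : ℝ) :
    ∃ ρ, ∀ e z, energy P Gp e z ≤ c → ‖e‖ ≤ ρ ∧ ‖z‖ ≤ ρ := by
  obtain ⟨i, hi⟩ := Finite.exists_max fun j =>
    max (Gp.b j) (2 * c / (Gp.a j * Gp.b j ^ Gp.μ j))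
  obtain ⟨n, hn⟩ := Finite.exists_max fun j => √(2 * c / P.mass j)
  set ρ₁ := max (Gp.b i) (2 * c / (Gp.a i * Gp.b i ^ Gp.μ i))
  set ρ₂ := √(2 * c / P.mass n)
  have hρ₁ : 0 ≤ ρ₁ := (hGp i).2.1.le.trans (le_max_left _ _)
  refine ⟨max ρ₁ ρ₂, fun e z h => ?_⟩
  have hterm : ∀ j, P.mass j * z j ^ 2 / 2 + Gp.potential j (e j) ≤ c := fun j =>
    (Finset.single_le_sum (f := fun j => P.mass j * z j ^ 2 / 2 + Gp.potential j (e j))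
      (fun j _ => add_nonneg (by have := P.mass_pos hM j; positivity)
        (Gain.potential_nonneg hGp j _)) (Finset.mem_univ j)).trans h
  constructor
  · refine (pi_norm_le_iff_of_nonneg (hρ₁.trans (le_max_left _ _))).2 fun j => ?_
    have hm := P.mass_pos hM j
    have : Gp.potential j (e j) ≤ c := le_trans (le_add_of_nonneg_left (by positivity)) (hterm j)
    exact ((Gain.abs_le_of_potential_le hGp this).trans (hi j)).trans (le_max_left _ _)
  · refine (pi_norm_le_iff_of_nonneg (hρ₁.trans (le_max_left _ _))).2 fun j => ?_
    have hm := P.mass_pos hM j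
    have h1 := Gain.potential_nonneg hGp j (e j)
    refine ((Real.abs_le_sqrt ?_).trans (hn j)).trans (le_max_right _ _)
    rw [le_div_iff₀ hm]
    linarith [hterm j]

theorem exists_crossTerm_le (hM : P.M.PosDef) :
    ∃ q > 0, ∀ θ e z, |crossTerm P θ e z| ≤ q * (e ⬝ᵥ e + z ⬝ᵥ z) := by
  obtain ⟨i, hi⟩ := Finite.exists_max P.mass
  have hm := P.mass_pos hM i
  -- Cauchy–Schwarz and the isometry `R` bound the cross term by `|e|² + |M z|²`, and `|M z|² ≤
  -- mass² |z|²`.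
  refine ⟨1 + P.mass i ^ 2, by positivity, fun θ e z => ?_⟩
  set y := P.M *ᵥ z with hy
  have h1 := dotProduct_sq_le e (R θ *ᵥ y)
  rw [R_mulVec_dotProduct_R_mulVec] at h1
  have h2 : y ⬝ᵥ y ≤ P.mass i ^ 2 * (z ⬝ᵥ z) := by
    rw [dotProduct, dotProduct, Finset.mul_sum]
    refine Finset.sum_le_sum fun j _ => ?_
    rw [hy, P.M_mulVec_apply]
    have h3 : P.mass j ^ 2 ≤ P.mass i ^ 2 := pow_le_pow_left₀ (P.mass_pos hM j).le (hi j) 2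
    have h4 := mul_le_mul_of_nonneg_right h3 (mul_self_nonneg (z j))
    linarith
  have he := dotProduct_self_nonneg e
  have hz := dotProduct_self_nonneg z
  have hyy := dotProduct_self_nonneg y
  have h5 : |crossTerm P θ e z| ≤ e ⬝ᵥ e + y ⬝ᵥ y := by
    refine abs_le_of_sq_le_sq (h1.trans ?_) (by positivity)
    nlinarith
  have h6 : 0 ≤ P.mass i ^ 2 * (e ⬝ᵥ e) := by positivity
  linarith

theorem continuous_R : Continuous R := by
  refine continuous_matrix fun i j => ?_
  fin_cases i <;> fin_cases j <;> simp [R] <;> fun_prop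

/-- Coupling of position error and velocity error in the rate of the cross term, at the yaw angle
`θ`, the reference velocity `β` and the body-frame velocity error `z`. -/
noncomputable def coupling (P : Params) (Gv : Gain) (θ : ℝ) (β z : Vec3) : Mat3 :=
  Rdot θ (((R θ)ᵀ *ᵥ β - z) 2) * P.M - R θ * P.C ((R θ)ᵀ *ᵥ β - z)
    - R θ * P.D ((R θ)ᵀ *ᵥ β - z) - Gv.K (R θ *ᵥ z) * R θ

theorem continuous_coupling (P : Params) (hGv : Gv.Admissible) :
    Continuous fun p : ℝ × Vec3 × Vec3 => coupling P Gv p.1 p.2.1 p.2.2 := by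
  have hR : Continuous fun p : ℝ × Vec3 × Vec3 => R p.1 := continuous_R.comp continuous_fst
  have hν : Continuous fun p : ℝ × Vec3 × Vec3 => (R p.1)ᵀ *ᵥ p.2.1 - p.2.2 :=
    (hR.matrix_transpose.matrix_mulVec (by fun_prop)).sub (by fun_prop)
  have hs : Continuous fun p : ℝ × Vec3 × Vec3 => R p.1 *ᵥ p.2.2 :=
    hR.matrix_mulVec (by fun_prop)
  have hC : Continuous P.C := continuous_matrix fun i j => by
    fin_cases i <;> fin_cases j <;> simp [Params.C] <;> fun_prop
  have hD : Continuous P.D := Continuous.matrix_diagonal <| continuous_pi fun j => by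
    fin_cases j <;> simp <;> fun_prop
  have hK : Continuous Gv.K := Continuous.matrix_diagonal <| continuous_pi fun j =>
    (Gain.locallyLipschitz_k hGv j).continuous.comp (continuous_apply j)
  have hRd : Continuous fun p : ℝ × ℝ => Rdot p.1 p.2 := continuous_matrix fun i j => by
    fin_cases i <;> fin_cases j <;> simp [Rdot] <;> fun_prop
  have hν2 := (continuous_apply (2 : Fin 3)).comp hν
  exact ((((hRd.comp (continuous_fst.prodMk hν2)).matrix_mul continuous_const).sub
    (hR.matrix_mul (hC.comp hν))).sub (hR.matrix_mul (hD.comp hν))).sub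
    ((hK.comp hs).matrix_mul hR)

/-- The yaw angle is unbounded, but the coupling is `2π`-periodic in it, so continuity on a compact
set gives a bound uniform in time. -/
theorem exists_coupling_le (P : Params) (hGv : Gv.Admissible) (B ρ : ℝ) :
    ∃ q, ∀ θ β z, ‖β‖ ≤ B → ‖z‖ ≤ ρ → ∀ i j, |coupling P Gv θ β z i j| ≤ q := by
  have hcomp : IsCompact (Set.Icc 0 (2 * Real.pi) ×ˢ
      (Metric.closedBall (0 : Vec3) B ×ˢ Metric.closedBall (0 : Vec3) ρ)) :=
    isCompact_Icc.prod ((isCompact_closedBall _ _).prod (isCompact_closedBall _ _))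
  choose q hq using fun i j => hcomp.exists_bound_of_continuousOn
    ((continuous_coupling P hGv).matrix_elem i j).continuousOn
  obtain ⟨m, hm⟩ := Finite.exists_max fun p : Fin 3 × Fin 3 => q p.1 p.2
  refine ⟨q m.1 m.2, fun θ β z hβ hz i j => ?_⟩
  have hper : Function.Periodic (fun θ => coupling P Gv θ β z) (2 * Real.pi) := by
    intro θ
    simp [coupling, R, Rdot]
  obtain ⟨θ', hθ', heq⟩ := hper.exists_mem_Ico₀ Real.two_pi_pos θ
  rw [show coupling P Gv θ β z = coupling P Gv θ' β z from heq]
  exact (hq i j (θ', β, z) ⟨Set.Ico_subset_Icc_self hθ', by simpa using hβ,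
    by simpa using hz⟩).trans (hm (i, j))

/-- Strict Lyapunov function of the undisturbed error system on a bounded region. -/
theorem exists_strict_lyapunov (hM : P.M.PosDef) (hD : ∀ ν : Vec3, (P.D ν).PosDef)
    (hGp : Gp.Admissible) (hGv : Gv.Admissible) (B ρ : ℝ) :
    ∃ κ l u α : ℝ, 0 < l ∧ 0 < u ∧ 0 < α ∧
      ∀ θ β e z, ‖β‖ ≤ B → ‖e‖ ≤ ρ → ‖z‖ ≤ ρ →
        l * (e ⬝ᵥ e + z ⬝ᵥ z) ≤ energy P Gp e z + κ * crossTerm P θ e z ∧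
        energy P Gp e z + κ * crossTerm P θ e z ≤ u * (e ⬝ᵥ e + z ⬝ᵥ z) ∧
        ∀ ν z', ν = (R θ)ᵀ *ᵥ β - z →
          P.M *ᵥ z' + P.C ν *ᵥ z + P.D ν *ᵥ z + feedback Gp Gv θ e z = 0 →
          z ⬝ᵥ P.M *ᵥ z' + (R θ *ᵥ z) ⬝ᵥ Gp.K e *ᵥ e
            + κ * ((R θ *ᵥ z) ⬝ᵥ R θ *ᵥ P.M *ᵥ z + e ⬝ᵥ Rdot θ (ν 2) *ᵥ P.M *ᵥ z
              + e ⬝ᵥ R θ *ᵥ P.M *ᵥ z')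
            + α * (energy P Gp e z + κ * crossTerm P θ e z) ≤ 0 := by
  obtain ⟨c, hc, hdamp⟩ := P.exists_damping_ge hD
  obtain ⟨l, hl, hlow⟩ := exists_energy_ge hM hGp ρ
  obtain ⟨u, hu, hMu, hup⟩ := exists_energy_le P hGp
  obtain ⟨q₁, hq₁, hcross⟩ := exists_crossTerm_le hM
  obtain ⟨q, hq⟩ := exists_coupling_le P hGv B ρ
  -- Coefficient of `z ⬝ z` in the bound for the cross term rate: `u` from `z ⬝ M z`, the rest from
  -- Young's inequality on the coupling, whose other half costs `l / 2` of the `l` available in `e ⬝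
  -- e`.
  set A := u + 9 * q ^ 2 / (2 * l) with hA
  have hApos : 0 < A := by positivity
  -- The first entry lets the cross term consume at most half of the damping; the second keeps it
  -- within half of the lower bound on the energy.
  set κ := min (c / (2 * A)) (l / (2 * q₁)) with hκ
  have hκpos : 0 < κ := by positivity
  have hκ1 : κ * A ≤ c / 2 := by
    have : κ ≤ c / (2 * A) := min_le_left _ _
    rw [le_div_iff₀ (by positivity)] at this
    linarith
  have hκ2 : κ * q₁ ≤ l / 2 := by
    have : κ ≤ l / (2 * q₁) := min_le_right _ _
    rw [le_div_iff₀ (by positivity)] at this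
    linarith
  -- Remaining dissipation rates in `z ⬝ z` and `e ⬝ e`; division by `u + l / 2` converts them into
  -- a rate relative to the Lyapunov function.
  set α₀ := min (c / 2) (κ * l / 2) with hα₀
  have hα₀pos : 0 < α₀ := by positivity
  refine ⟨κ, l / 2, u + l / 2, α₀ / (u + l / 2), by positivity, by positivity, by positivity,
    fun θ β e z hβ he hz => ?_⟩
  have hE := dotProduct_self_nonneg e
  have hZ := dotProduct_self_nonneg z
  set E := e ⬝ᵥ e with hEdef
  set Z := z ⬝ᵥ z with hZdef
  have hx : |κ * crossTerm P θ e z| ≤ l / 2 * (E + Z) := by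
    rw [abs_mul, abs_of_pos hκpos]
    calc κ * |crossTerm P θ e z| ≤ κ * (q₁ * (E + Z)) := by
          gcongr
          exact hcross θ e z
      _ = κ * q₁ * (E + Z) := by ring
      _ ≤ _ := by gcongr
  obtain ⟨hx1, hx2⟩ := abs_le.1 hx
  have hl1 := (hlow e he).2 z
  have hu1 := hup e z
  refine ⟨by linarith, by linarith, fun ν z' hν heq => ?_⟩
  have hup' : energy P Gp e z + κ * crossTerm P θ e z ≤ (u + l / 2) * (E + Z) := by linarith
  have hαW : α₀ / (u + l / 2) * (energy P Gp e z + κ * crossTerm P θ e z) ≤ α₀ * (E + Z) := by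
    calc _ ≤ α₀ / (u + l / 2) * ((u + l / 2) * (E + Z)) := by gcongr
      _ = _ := by field_simp
  have hrate := energy_rate (w := 0) (by rw [add_zero]; exact heq)
  have hcr := crossTerm_rate (r := ν 2) heq
  rw [dotProduct_zero, sub_zero] at hrate
  have hQ : Rdot θ (ν 2) * P.M - R θ * P.C ν - R θ * P.D ν - Gv.K (R θ *ᵥ z) * R θ
      = coupling P Gv θ β z := by rw [coupling, ← hν]
  rw [hQ] at hcr
  have hX := dotProduct_mulVec_sq_le (hq θ β z hβ hz) e z
  set X := e ⬝ᵥ coupling P Gv θ β z *ᵥ z with hXdef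
  have hXle : X ≤ l / 2 * E + 9 * q ^ 2 / (2 * l) * Z := by
    refine (abs_le.1 (abs_le_of_sq_le_sq (hX.trans ?_) (by positivity))).2
    have h1 : (l / 2 * E + 9 * q ^ 2 / (2 * l) * Z) ^ 2
        = (l / 2 * E - 9 * q ^ 2 / (2 * l) * Z) ^ 2 + 9 * q ^ 2 * (E * Z) := by
      field_simp
      ring
    rw [h1]
    linarith [sq_nonneg (l / 2 * E - 9 * q ^ 2 / (2 * l) * Z)]
  have hDz : c * Z ≤ z ⬝ᵥ P.D ν *ᵥ z := le_diagonal_quadratic (hdamp ν) z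
  have hKv := K_quadratic_nonneg hGv (R θ *ᵥ z) (R θ *ᵥ z)
  have hKp := (hlow e he).1
  have hMz := hMu z
  rw [hrate, hcr]
  have hbr : z ⬝ᵥ P.M *ᵥ z - e ⬝ᵥ Gp.K e *ᵥ e + X ≤ A * Z - l / 2 * E := by
    rw [hA]
    linarith
  have hbr' := mul_le_mul_of_nonneg_left hbr hκpos.le
  have hAZ := mul_le_mul_of_nonneg_right hκ1 hZ
  have h1 : α₀ * Z ≤ c / 2 * Z := mul_le_mul_of_nonneg_right (min_le_left _ _) hZ
  have h2 : α₀ * E ≤ κ * l / 2 * E := mul_le_mul_of_nonneg_right (min_le_right _ _) hE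
  linarith

end Energy

end AUV

/-! ### Local Lipschitz regularity of the closed loop -/

namespace AUV

section Regularity

variable {X : Type*} [SeminormedAddCommGroup X]

theorem locallyLipschitz_R {θ : X → ℝ} (hθ : LocallyLipschitz θ) (i j : Fin 3) :
    LocallyLipschitz fun x => R (θ x) i j := by
  have h : LocallyLipschitz fun s : ℝ => R s i j := by
    refine ContDiff.locallyLipschitz (𝕂 := ℝ) ?_
    fin_cases i <;> fin_cases j <;> simp [R] <;> fun_prop
  exact h.comp hθ

theorem locallyLipschitz_R_mulVec {θ : X → ℝ} {v : X → Vec3} (hθ : LocallyLipschitz θ)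
    (hv : LocallyLipschitz v) : LocallyLipschitz fun x => R (θ x) *ᵥ v x :=
  LocallyLipschitz.mulVec (locallyLipschitz_R hθ) hv

theorem locallyLipschitz_R_transpose_mulVec {θ : X → ℝ} {v : X → Vec3} (hθ : LocallyLipschitz θ)
    (hv : LocallyLipschitz v) : LocallyLipschitz fun x => (R (θ x))ᵀ *ᵥ v x :=
  LocallyLipschitz.mulVec (fun i j => locallyLipschitz_R hθ j i) hv

theorem locallyLipschitz_M_mulVec (P : Params) {v : X → Vec3} (hv : LocallyLipschitz v) :
    LocallyLipschitz fun x => P.M *ᵥ v x :=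
  LocallyLipschitz.mulVec (fun _ _ => LocallyLipschitz.const _) hv

theorem locallyLipschitz_K_mulVec {G : Gain} (hG : G.Admissible) {v : X → Vec3}
    (hv : LocallyLipschitz v) : LocallyLipschitz fun x => G.K (v x) *ᵥ v x := by
  refine LocallyLipschitz.finPi fun j => ?_
  simp only [Gain.K, Matrix.mulVec_diagonal]
  exact ((Gain.locallyLipschitz_k hG j).comp (hv.eval j)).mul_real (hv.eval j)

theorem locallyLipschitz_C_mulVec (P : Params) {ν v : X → Vec3} (hν : LocallyLipschitz ν)
    (hv : LocallyLipschitz v) : LocallyLipschitz fun x => P.C (ν x) *ᵥ v x := by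
  refine LocallyLipschitz.mulVec (fun i j => ?_) hv
  have h : LocallyLipschitz fun ν : Vec3 => P.C ν i j := by
    refine ContDiff.locallyLipschitz (𝕂 := ℝ) ?_
    fin_cases i <;> fin_cases j <;> simp [Params.C] <;> fun_prop
  exact h.comp hν

theorem locallyLipschitz_D_mulVec (P : Params) {ν v : X → Vec3} (hν : LocallyLipschitz ν)
    (hv : LocallyLipschitz v) : LocallyLipschitz fun x => P.D (ν x) *ᵥ v x := by
  refine LocallyLipschitz.finPi fun j => ?_
  simp only [P.D_eq, Matrix.mulVec_diagonal]
  refine LocallyLipschitz.mul_real ?_ (hv.eval j)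
  have h : ∀ a b : ℝ, ∀ i, LocallyLipschitz fun x => a - b * |ν x i| := fun a b i =>
    (LocallyLipschitz.const a).sub ((LocallyLipschitz.const b).mul_real
      ((lipschitzWith_one_norm (E := ℝ)).locallyLipschitz.comp (hν.eval i)))
  fin_cases j
  · exact h _ _ 0
  · exact h _ _ 1
  · exact h _ _ 2

theorem locallyLipschitz_feedback {Gp Gv : Gain} (hGp : Gp.Admissible) (hGv : Gv.Admissible)
    {θ : X → ℝ} {e z : X → Vec3} (hθ : LocallyLipschitz θ) (he : LocallyLipschitz e)
    (hz : LocallyLipschitz z) : LocallyLipschitz fun x => feedback Gp Gv (θ x) (e x) (z x) :=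
  locallyLipschitz_R_transpose_mulVec hθ ((locallyLipschitz_K_mulVec hGp he).add
    (locallyLipschitz_K_mulVec hGv (locallyLipschitz_R_mulVec hθ hz)))

theorem locallyLipschitz_energy (P : Params) {Gp : Gain} (hGp : Gp.Admissible) {e z : X → Vec3}
    (he : LocallyLipschitz e) (hz : LocallyLipschitz z) :
    LocallyLipschitz fun x => energy P Gp (e x) (z x) := by
  refine LocallyLipschitz.sum_real _ fun j => LocallyLipschitz.add ?_
    ((Gain.locallyLipschitz_potential hGp j).comp (he.eval j))
  have h : LocallyLipschitz fun s : ℝ => P.mass j * s ^ 2 / 2 :=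
    ContDiff.locallyLipschitz (𝕂 := ℝ) (by fun_prop)
  exact h.comp (hz.eval j)

theorem locallyLipschitz_crossTerm (P : Params) {θ : X → ℝ} {e z : X → Vec3}
    (hθ : LocallyLipschitz θ) (he : LocallyLipschitz e) (hz : LocallyLipschitz z) :
    LocallyLipschitz fun x => crossTerm P (θ x) (e x) (z x) :=
  he.dotProduct (locallyLipschitz_R_mulVec hθ (locallyLipschitz_M_mulVec P hz))

variable {ref : ℝ → Vec3}

theorem contDiff_deriv (href : ContDiff ℝ 2 ref) : ContDiff ℝ 1 (deriv ref) :=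
  ((contDiff_succ_iff_deriv (n := 1)).1 href).2.2

theorem hasDerivAt_ref (href : ContDiff ℝ 2 ref) (t : ℝ) : HasDerivAt ref (deriv ref t) t :=
  (href.differentiable (by norm_num) t).hasDerivAt

theorem hasDerivAt_deriv_ref (href : ContDiff ℝ 2 ref) (t : ℝ) :
    HasDerivAt (deriv ref) (deriv (deriv ref) t) t :=
  ((contDiff_deriv href).differentiable (by norm_num) t).hasDerivAt

theorem locallyLipschitz_ref (href : ContDiff ℝ 2 ref) : LocallyLipschitz ref :=
  (href.of_le (by norm_num)).locallyLipschitz (𝕂 := ℝ)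

theorem locallyLipschitz_posErr (href : ContDiff ℝ 2 ref) :
    LocallyLipschitz fun p : ℝ × Vec3 × Vec3 => posErr ref p.1 p.2.1 :=
  ((locallyLipschitz_ref href).comp LipschitzWith.prod_fst.locallyLipschitz).sub
    (LipschitzWith.prod_fst.locallyLipschitz.comp LipschitzWith.prod_snd.locallyLipschitz)

theorem locallyLipschitz_yaw : LocallyLipschitz fun p : ℝ × Vec3 × Vec3 => p.2.1 2 :=
  (LipschitzWith.prod_fst.locallyLipschitz.comp LipschitzWith.prod_snd.locallyLipschitz).eval 2

theorem locallyLipschitz_bodyErr (href : ContDiff ℝ 2 ref) :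
    LocallyLipschitz fun p : ℝ × Vec3 × Vec3 => bodyErr ref p.1 p.2.1 p.2.2 :=
  (locallyLipschitz_R_transpose_mulVec locallyLipschitz_yaw
    (((contDiff_deriv href).locallyLipschitz (𝕂 := ℝ)).comp
      LipschitzWith.prod_fst.locallyLipschitz)).sub
    (LipschitzWith.prod_snd.locallyLipschitz.comp LipschitzWith.prod_snd.locallyLipschitz)

end Regularity

/-! ### Dissipation along Carathéodory solutions and the finite gain -/

section Trajectories

variable {P : Params} {Gp Gv : Gain} {ref w : ℝ → Vec3} {t₀ T : ℝ} {η ν : ℝ → Vec3}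

theorem R_mulVec_apply_two (θ : ℝ) (v : Vec3) : (R θ *ᵥ v) 2 = v 2 := by
  simp [R, Matrix.mulVec, dotProduct, Fin.sum_univ_three]

namespace IsSolutionOn

theorem continuousOn_pose (h : IsSolutionOn P Gp Gv ref w t₀ T η ν) :
    ContinuousOn η (Set.Icc t₀ T) := fun t ht => (h.kinematics t ht).continuousWithinAt

theorem continuousOn_velocity (h : IsSolutionOn P Gp Gv ref w t₀ T η ν) (hT : t₀ ≤ T) :
    ContinuousOn ν (Set.Icc t₀ T) := by
  have := h.absCont.continuousOn
  rwa [Set.uIcc_of_le hT] at this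

theorem continuousOn_state (h : IsSolutionOn P Gp Gv ref w t₀ T η ν) (hT : t₀ ≤ T) :
    ContinuousOn (fun t => (t, η t, ν t)) (Set.Icc t₀ T) :=
  continuousOn_id.prodMk (h.continuousOn_pose.prodMk (h.continuousOn_velocity hT))

theorem continuousOn_bodyErr (href : ContDiff ℝ 2 ref)
    (h : IsSolutionOn P Gp Gv ref w t₀ T η ν) (hT : t₀ ≤ T) :
    ContinuousOn (fun t => bodyErr ref t (η t) (ν t)) (Set.Icc t₀ T) :=
  (locallyLipschitz_bodyErr href).continuous.comp_continuousOn (f := fun t => (t, η t, ν t))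
    (h.continuousOn_state hT)

/-- The pose has a bounded derivative, hence is Lipschitz. Time is kept as a coordinate so that
explicitly time-dependent functions are covered by one composition. -/
theorem absolutelyContinuous_state (h : IsSolutionOn P Gp Gv ref w t₀ T η ν) (hT : t₀ ≤ T) :
    AbsolutelyContinuousOnInterval (fun t => (t, η t, ν t)) t₀ T := by
  have hη : AbsolutelyContinuousOnInterval η t₀ T := by
    have hR : ContinuousOn (fun t => R (η t 2) *ᵥ ν t) (Set.Icc t₀ T) := by
      have hf : Continuous fun p : ℝ × Vec3 => R p.1 *ᵥ p.2 :=
        (locallyLipschitz_R_mulVec LipschitzWith.prod_fst.locallyLipschitz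
          LipschitzWith.prod_snd.locallyLipschitz).continuous
      have h2 : ContinuousOn (fun t => η t 2) (Set.Icc t₀ T) := continuousOn_pi.1 h.continuousOn_pose 2
      exact Continuous.comp_continuousOn (f := fun t => (η t 2, ν t)) hf
        (h2.prodMk (h.continuousOn_velocity hT))
    obtain ⟨L, hL⟩ := isCompact_Icc.exists_bound_of_continuousOn hR
    have hlip := (convex_Icc t₀ T).lipschitzOnWith_of_nnnorm_hasDerivWithin_le (C := L.toNNReal)
      (fun t ht => h.kinematics t ht) (fun t ht => by
        rw [← NNReal.coe_le_coe, coe_nnnorm]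
        exact (hL t ht).trans (Real.le_coe_toNNReal L))
    refine LipschitzOnWith.absolutelyContinuousOnInterval (K := L.toNNReal) ?_
    rwa [Set.uIcc_of_le hT]
  have hid : AbsolutelyContinuousOnInterval (fun t : ℝ => t) t₀ T :=
    (LipschitzWith.id.lipschitzOnWith).absolutelyContinuousOnInterval
  exact hid.prodMk (hη.prodMk h.absCont)

/-- At almost every time the tracking errors are differentiable and satisfy the error system. -/
theorem ae_error_system (href : ContDiff ℝ 2 ref) (h : IsSolutionOn P Gp Gv ref w t₀ T η ν) :
    ∀ᵐ t ∂(volume.restrict (Set.Icc t₀ T)), t ∈ Set.Icc t₀ T ∧ ∃ z',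
      HasDerivAt (fun s => η s 2) (ν t 2) t ∧
      HasDerivAt (fun s => posErr ref s (η s)) (R (η t 2) *ᵥ bodyErr ref t (η t) (ν t)) t ∧
      HasDerivAt (fun s => bodyErr ref s (η s) (ν s)) z' t ∧
      P.M *ᵥ z' + P.C (ν t) *ᵥ bodyErr ref t (η t) (ν t)
        + P.D (ν t) *ᵥ bodyErr ref t (η t) (ν t)
        + feedback Gp Gv (η t 2) (posErr ref t (η t)) (bodyErr ref t (η t) (ν t)) + w t = 0 := by
  -- The endpoints are negligible, and at interior times the derivative within the interval is a
  -- full derivative.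
  have hIoo : ∀ᵐ t ∂(volume.restrict (Set.Icc t₀ T)), t ∈ Set.Ioo t₀ T := by
    rw [← restrict_Ioo_eq_restrict_Icc]
    exact ae_restrict_mem measurableSet_Ioo
  filter_upwards [h.dynamics, hIoo] with t ⟨ν', hν', hdyn⟩ ht
  have hη : HasDerivAt η (R (η t 2) *ᵥ ν t) t :=
    (h.kinematics t (Set.Ioo_subset_Icc_self ht)).hasDerivAt (Icc_mem_nhds ht.1 ht.2)
  have hyaw : HasDerivAt (fun s => η s 2) (ν t 2) t := by
    have := hasDerivAt_pi.1 hη 2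
    rwa [R_mulVec_apply_two] at this
  refine ⟨Set.Ioo_subset_Icc_self ht, _, hyaw, ?_, (hasDerivAt_R_transpose_mulVec hyaw
    (hasDerivAt_deriv_ref href t)).sub hν', (dynamics_iff ..).1 hdyn⟩
  rw [← velErr_eq]
  exact (hasDerivAt_ref href t).sub hη

/-- Dissipation inequality between the disturbance and the velocity error. -/
theorem ae_energy_rate (hGp : Gp.Admissible) (hGv : Gv.Admissible)
    (href : ContDiff ℝ 2 ref) (h : IsSolutionOn P Gp Gv ref w t₀ T η ν) {c : ℝ}
    (hc : ∀ ν j, c ≤ P.damping ν j) :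
    ∀ᵐ t ∂(volume.restrict (Set.Icc t₀ T)), ∃ d,
      HasDerivAt (fun s => energy P Gp (posErr ref s (η s)) (bodyErr ref s (η s) (ν s))) d t ∧
      d ≤ -(c * (bodyErr ref t (η t) (ν t) ⬝ᵥ bodyErr ref t (η t) (ν t)))
        - bodyErr ref t (η t) (ν t) ⬝ᵥ w t := by
  filter_upwards [h.ae_error_system href] with t ⟨_, z', _, he, hz, heq⟩
  refine ⟨_, hasDerivAt_energy P hGp he hz, ?_⟩
  rw [energy_rate heq]
  have h1 := le_diagonal_quadratic (hc (ν t)) (bodyErr ref t (η t) (ν t))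
  have h2 := K_quadratic_nonneg hGv (R (η t 2) *ᵥ bodyErr ref t (η t) (ν t))
    (R (η t 2) *ᵥ bodyErr ref t (η t) (ν t))
  rw [P.D_eq]
  linarith

theorem absolutelyContinuous_energy (hGp : Gp.Admissible) (href : ContDiff ℝ 2 ref)
    (h : IsSolutionOn P Gp Gv ref w t₀ T η ν) (hT : t₀ ≤ T) :
    AbsolutelyContinuousOnInterval
      (fun s => energy P Gp (posErr ref s (η s)) (bodyErr ref s (η s) (ν s))) t₀ T :=
  LocallyLipschitz.comp_absolutelyContinuousOnInterval (f := fun t => (t, η t, ν t))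
    (g := fun p => energy P Gp (posErr ref p.1 p.2.1) (bodyErr ref p.1 p.2.1 p.2.2))
    (locallyLipschitz_energy P hGp (locallyLipschitz_posErr href) (locallyLipschitz_bodyErr href))
    (h.absolutelyContinuous_state hT)

theorem energy_le (hD : ∀ ν, (P.D ν).PosDef) (hGp : Gp.Admissible)
    (hGv : Gv.Admissible) (href : ContDiff ℝ 2 ref) (h : IsSolutionOn P Gp Gv ref 0 t₀ T η ν)
    (hT : t₀ ≤ T) :
    energy P Gp (posErr ref T (η T)) (bodyErr ref T (η T) (ν T))
      ≤ energy P Gp (posErr ref t₀ (η t₀)) (bodyErr ref t₀ (η t₀) (ν t₀)) := by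
  obtain ⟨c, hc, hdamp⟩ := P.exists_damping_ge hD
  refine (h.absolutelyContinuous_energy hGp href hT).le_of_ae_deriv_nonpos hT ?_
  filter_upwards [h.ae_energy_rate hGp hGv href hdamp] with t ⟨d, hd, hle⟩
  refine ⟨d, hd, hle.trans ?_⟩
  have := dotProduct_self_nonneg (bodyErr ref t (η t) (ν t))
  simp only [Pi.zero_apply, dotProduct_zero, sub_zero, neg_nonpos]
  positivity

/-- The map from the disturbance to the velocity error has finite gain. -/
theorem integral_velErr_le (hM : P.M.PosDef) (hGp : Gp.Admissible)
    (hGv : Gv.Admissible) (href : ContDiff ℝ 2 ref) {c : ℝ} (hc : 0 < c)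
    (hdamp : ∀ ν j, c ≤ P.damping ν j) (hw : Measurable w) {B : ℝ}
    (hB : ∀ t ∈ Set.Icc t₀ T, ‖w t‖ ≤ B) (h : IsSolutionOn P Gp Gv ref w t₀ T η ν) (hT : t₀ ≤ T)
    (he : posErr ref t₀ (η t₀) = 0) (hv : velErr ref t₀ (η t₀) (ν t₀) = 0) :
    ∫ t in t₀..T, (velErr ref t (η t) (ν t) ⬝ᵥ velErr ref t (η t) (ν t)
      - c⁻¹ ^ 2 * (w t ⬝ᵥ w t)) ≤ 0 := by
  have hz0 : bodyErr ref t₀ (η t₀) (ν t₀) = 0 := by rw [bodyErr_eq, hv, Matrix.mulVec_zero]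
  have hzz : ∀ t, velErr ref t (η t) (ν t) ⬝ᵥ velErr ref t (η t) (ν t)
      = bodyErr ref t (η t) (ν t) ⬝ᵥ bodyErr ref t (η t) (ν t) := fun t => by
    rw [velErr_eq, R_mulVec_dotProduct_R_mulVec]
  simp only [hzz]
  have hzint : IntervalIntegrable
      (fun t => bodyErr ref t (η t) (ν t) ⬝ᵥ bodyErr ref t (η t) (ν t)) volume t₀ T := by
    refine ContinuousOn.intervalIntegrable ?_
    rw [Set.uIcc_of_le hT]
    have hz := h.continuousOn_bodyErr href hT
    exact continuousOn_finsetSum _ fun i _ =>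
      (continuousOn_pi.1 hz i).mul (continuousOn_pi.1 hz i)
  have hwint : IntervalIntegrable (fun t => w t ⬝ᵥ w t) volume t₀ T := by
    rw [intervalIntegrable_iff, Set.uIoc_of_le hT]
    have hmeas : Measurable fun t => w t ⬝ᵥ w t := by
      simp only [dotProduct]
      fun_prop
    refine Measure.integrableOn_of_bounded (M := 3 * B ^ 2) (by simp) hmeas.aestronglyMeasurable ?_
    filter_upwards [ae_restrict_mem measurableSet_Ioc] with t ht
    rw [Real.norm_of_nonneg (dotProduct_self_nonneg _)]
    refine (dotProduct_self_le _).trans ?_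
    gcongr
    exact hB t (Set.Ioc_subset_Icc_self ht)
  set g : ℝ → ℝ := fun t => bodyErr ref t (η t) (ν t) ⬝ᵥ bodyErr ref t (η t) (ν t)
      - c⁻¹ ^ 2 * (w t ⬝ᵥ w t) with hg
  have hgint : IntervalIntegrable g volume t₀ T := hzint.sub (hwint.const_mul _)
  have hle := (h.absolutelyContinuous_energy hGp href hT).sub_le_integral hT
    (hgint.const_mul (-(c / 2))) (by
      filter_upwards [h.ae_energy_rate hGp hGv href hdamp] with t ⟨d, hd, hle⟩
      refine ⟨d, hd, hle.trans ?_⟩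
      -- `|c z + w|² / (2c) ≥ 0` is exactly `-c |z|² - z ⬝ w ≤ -(c / 2) (|z|² - c⁻² |w|²)`.
      have hsq := dotProduct_self_nonneg (c • bodyErr ref t (η t) (ν t) + w t)
      simp only [dotProduct_add, add_dotProduct, smul_dotProduct, dotProduct_smul,
        smul_eq_mul] at hsq
      rw [dotProduct_comm (w t)] at hsq
      set Z := bodyErr ref t (η t) (ν t) ⬝ᵥ bodyErr ref t (η t) (ν t)
      set Y := bodyErr ref t (η t) (ν t) ⬝ᵥ w t
      have hgt : -(c / 2) * g t = -(c / 2) * Z + (2 * c)⁻¹ * (w t ⬝ᵥ w t) := by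
        simp only [hg]
        field_simp
        ring
      rw [hgt]
      have : 0 ≤ (2 * c)⁻¹ * (c * (c * Z) + c * Y + (c * Y + w t ⬝ᵥ w t)) := by
        refine mul_nonneg (by positivity) (by linarith)
      have h2 : (2 * c)⁻¹ * (c * (c * Z) + c * Y + (c * Y + w t ⬝ᵥ w t))
          = c / 2 * Z + Y + (2 * c)⁻¹ * (w t ⬝ᵥ w t) := by
        field_simp
        ring
      linarith)
  rw [intervalIntegral.integral_const_mul, he, hz0, energy_zero, sub_zero] at hle
  -- The energy starts at zero and ends nonnegative, so `-(c / 2)` times the integral is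
  -- nonnegative.
  have h0 := (energy_nonneg hM hGp (posErr ref T (η T)) (bodyErr ref T (η T) (ν T))).trans hle
  nlinarith

end IsSolutionOn

end Trajectories

end AUV

/-! ### Exponential decay and asymptotic stability -/

namespace AUV

section Stability

variable {P : Params} {Gp Gv : Gain} {ref : ℝ → Vec3}

/-- Rotation preserves the dot product; the rest compares the sup norm with the Euclidean one on six
coordinates. -/
theorem error_norm_bounds (ref : ℝ → Vec3) (t : ℝ) (η ν : Vec3) :
    ‖(posErr ref t η, velErr ref t η ν)‖ ^ 2 ≤
        posErr ref t η ⬝ᵥ posErr ref t η + bodyErr ref t η ν ⬝ᵥ bodyErr ref t η ν ∧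
      posErr ref t η ⬝ᵥ posErr ref t η + bodyErr ref t η ν ⬝ᵥ bodyErr ref t η ν ≤
        6 * ‖(posErr ref t η, velErr ref t η ν)‖ ^ 2 := by
  have hz : bodyErr ref t η ν ⬝ᵥ bodyErr ref t η ν = velErr ref t η ν ⬝ᵥ velErr ref t η ν := by
    rw [velErr_eq, R_mulVec_dotProduct_R_mulVec]
  rw [hz]
  set e := posErr ref t η
  set s := velErr ref t η ν
  have h1 := norm_sq_le_dotProduct_self e
  have h2 := norm_sq_le_dotProduct_self s
  have h3 := dotProduct_self_le e
  have h4 := dotProduct_self_le s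
  have h5 : ‖e‖ ^ 2 ≤ ‖(e, s)‖ ^ 2 := pow_le_pow_left₀ (norm_nonneg _) (norm_fst_le (e, s)) 2
  have h6 : ‖s‖ ^ 2 ≤ ‖(e, s)‖ ^ 2 := pow_le_pow_left₀ (norm_nonneg _) (norm_snd_le (e, s)) 2
  refine ⟨?_, by linarith⟩
  rw [Prod.norm_def]
  rcases max_choice ‖e‖ ‖s‖ with h | h
  · rw [h]
    linarith [dotProduct_self_nonneg s]
  · rw [h]
    linarith [dotProduct_self_nonneg e]

/-- Errors that start in a bounded region decay exponentially, at a rate depending on the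
region. -/
theorem exists_exponential_decay (hM : P.M.PosDef) (hD : ∀ ν : Vec3, (P.D ν).PosDef)
    (hGp : Gp.Admissible) (hGv : Gv.Admissible) (href : ContDiff ℝ 2 ref) {B : ℝ}
    (hB : ∀ t, 0 ≤ t → ‖deriv ref t‖ ≤ B) (r : ℝ) :
    ∃ K > 0, ∃ α > 0, ∀ t₀, 0 ≤ t₀ → ∀ x, IsErrorTrajectory P Gp Gv ref t₀ x → ‖x t₀‖ < r →
      ∀ t, t₀ ≤ t → ‖x t‖ ^ 2 ≤ K * ‖x t₀‖ ^ 2 * Real.exp (-(α * (t - t₀))) := by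
  obtain ⟨u₀, hu₀, -, hup⟩ := exists_energy_le P hGp
  -- Upper bound of the initial energy when the error starts below `r`. Energy does not increase, so
  -- `ρ` bounds the whole trajectory.
  obtain ⟨ρ, hρ⟩ := exists_norm_le_of_energy_le hM hGp (u₀ * (6 * r ^ 2))
  obtain ⟨κ, l, u, α, hl, hu, hα, hlyap⟩ := exists_strict_lyapunov hM hD hGp hGv B ρ
  refine ⟨6 * u / l, by positivity, α, hα, fun t₀ ht₀ x ⟨η, ν, hsol, hx⟩ hr t ht => ?_⟩
  set e : ℝ → Vec3 := fun s => posErr ref s (η s) with he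
  set z : ℝ → Vec3 := fun s => bodyErr ref s (η s) (ν s) with hz
  have hN : ∀ s, t₀ ≤ s → ‖x s‖ ^ 2 ≤ e s ⬝ᵥ e s + z s ⬝ᵥ z s ∧
      e s ⬝ᵥ e s + z s ⬝ᵥ z s ≤ 6 * ‖x s‖ ^ 2 := fun s hs => by
    rw [hx s hs]
    exact error_norm_bounds ref s (η s) (ν s)
  have hb : ∀ s, t₀ ≤ s → ‖e s‖ ≤ ρ ∧ ‖z s‖ ≤ ρ := by
    intro s hs
    refine hρ _ _ (((hsol s hs).energy_le hD hGp hGv href hs).trans ((hup _ _).trans ?_))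
    have h1 : ‖x t₀‖ ^ 2 ≤ r ^ 2 := pow_le_pow_left₀ (norm_nonneg _) hr.le 2
    have h2 := (hN t₀ le_rfl).2
    gcongr
    linarith
  set W : ℝ → ℝ := fun s => energy P Gp (e s) (z s) + κ * crossTerm P (η s 2) (e s) (z s) with hW
  have hlow : ∀ s, t₀ ≤ s → l * (e s ⬝ᵥ e s + z s ⬝ᵥ z s) ≤ W s ∧
      W s ≤ u * (e s ⬝ᵥ e s + z s ⬝ᵥ z s) := fun s hs =>
    have h := hlyap (η s 2) (deriv ref s) (e s) (z s) (hB s (ht₀.trans hs)) (hb s hs).1 (hb s hs).2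
    ⟨h.1, h.2.1⟩
  -- Grönwall by integrating factor: the product is absolutely continuous with nonpositive
  -- derivative almost everywhere.
  have hdecay : W t * Real.exp (α * (t - t₀)) ≤ W t₀ * Real.exp (α * (t₀ - t₀)) := by
    have hexp : LocallyLipschitz fun s : ℝ => Real.exp (α * (s - t₀)) :=
      ContDiff.locallyLipschitz (𝕂 := ℝ) (by fun_prop)
    have hAC : AbsolutelyContinuousOnInterval (fun s => W s * Real.exp (α * (s - t₀))) t₀ t :=
      LocallyLipschitz.comp_absolutelyContinuousOnInterval (f := fun t => (t, η t, ν t))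
        (g := fun p => (energy P Gp (posErr ref p.1 p.2.1) (bodyErr ref p.1 p.2.1 p.2.2)
          + κ * crossTerm P (p.2.1 2) (posErr ref p.1 p.2.1) (bodyErr ref p.1 p.2.1 p.2.2))
          * Real.exp (α * (p.1 - t₀)))
        (((locallyLipschitz_energy P hGp (locallyLipschitz_posErr href)
          (locallyLipschitz_bodyErr href)).add ((LocallyLipschitz.const κ).mul_real
            (locallyLipschitz_crossTerm P locallyLipschitz_yaw (locallyLipschitz_posErr href)
              (locallyLipschitz_bodyErr href)))).mul_real
          (hexp.comp LipschitzWith.prod_fst.locallyLipschitz))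
        ((hsol t ht).absolutelyContinuous_state ht)
    refine hAC.le_of_ae_deriv_nonpos ht ?_
    filter_upwards [(hsol t ht).ae_error_system href] with s ⟨hs, z', hyaw, hde, hdz, heq⟩
    have hdW := (hasDerivAt_energy P hGp hde hdz).add
      ((hasDerivAt_crossTerm P hyaw hde hdz).const_mul κ)
    have hdexp : HasDerivAt (fun s : ℝ => Real.exp (α * (s - t₀)))
        (Real.exp (α * (s - t₀)) * α) s := by
      have := (((hasDerivAt_id s).sub_const t₀).const_mul α).exp
      simpa using this
    refine ⟨_, hdW.mul hdexp, ?_⟩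
    have h := (hlyap (η s 2) (deriv ref s) (e s) (z s) (hB s (ht₀.trans hs.1)) (hb s hs.1).1
      (hb s hs.1).2).2.2 (ν s) z' (sub_sub_cancel _ _).symm
      (by rw [Pi.zero_apply, add_zero] at heq; exact heq)
    have h' := mul_nonpos_of_nonneg_of_nonpos (Real.exp_pos (α * (s - t₀))).le h
    refine le_trans (le_of_eq ?_) h'
    simp only [Pi.add_apply, he, hz]
    ring
  rw [sub_self, mul_zero, Real.exp_zero, mul_one] at hdecay
  have h1 := (hlow t ht).1
  have h2 := (hlow t₀ le_rfl).2
  have h3 := (hN t ht).1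
  have h4 := (hN t₀ le_rfl).2
  have hE := Real.exp_pos (α * (t - t₀))
  rw [Real.exp_neg, ← div_eq_mul_inv, le_div_iff₀ hE]
  have h5 : l * (‖x t‖ ^ 2 * Real.exp (α * (t - t₀))) ≤ u * (6 * ‖x t₀‖ ^ 2) := by
    calc l * (‖x t‖ ^ 2 * Real.exp (α * (t - t₀)))
        ≤ l * ((e t ⬝ᵥ e t + z t ⬝ᵥ z t) * Real.exp (α * (t - t₀))) := by gcongr
      _ = l * (e t ⬝ᵥ e t + z t ⬝ᵥ z t) * Real.exp (α * (t - t₀)) := by ring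
      _ ≤ W t * Real.exp (α * (t - t₀)) := by gcongr
      _ ≤ W t₀ := hdecay
      _ ≤ u * (e t₀ ⬝ᵥ e t₀ + z t₀ ⬝ᵥ z t₀) := h2
      _ ≤ _ := by gcongr
  rw [show 6 * u / l * ‖x t₀‖ ^ 2 = u * (6 * ‖x t₀‖ ^ 2) / l by ring, le_div_iff₀ hl]
  linarith

/-- Decay constants may depend on the radius `r` of initial errors: stability only needs `r = 1`,
and the other two properties fix `r` beforehand. -/
theorem isGloballyUniformlyAsymptoticallyStable_of_exponential_decay {E : Type*}
    [NormedAddCommGroup E] {sol : ℝ → (ℝ → E) → Prop}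
    (hex : ∀ t₀, 0 ≤ t₀ → ∀ x₀ : E, ∃ x, sol t₀ x ∧ x t₀ = x₀)
    (hdec : ∀ r : ℝ, ∃ K > 0, ∃ α > 0, ∀ t₀, 0 ≤ t₀ → ∀ x, sol t₀ x → ‖x t₀‖ < r →
      ∀ t, t₀ ≤ t → ‖x t‖ ^ 2 ≤ K * ‖x t₀‖ ^ 2 * Real.exp (-(α * (t - t₀)))) :
    IsGloballyUniformlyAsymptoticallyStable sol := by
  have hbound : ∀ r : ℝ, ∃ K > 0, ∀ t₀, 0 ≤ t₀ → ∀ x, sol t₀ x → ‖x t₀‖ < r →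
      ∀ t, t₀ ≤ t → ‖x t‖ ≤ (K + 1) * ‖x t₀‖ := by
    intro r
    obtain ⟨K, hK, α, hα, h⟩ := hdec r
    refine ⟨K, hK, fun t₀ ht₀ x hx hr t ht => ?_⟩
    -- `K ≤ (K + 1)²` avoids a square root.
    refine le_of_sq_le_sq ?_ (by positivity)
    have h1 : Real.exp (-(α * (t - t₀))) ≤ 1 :=
      Real.exp_le_one_iff.2 (neg_nonpos.2 (mul_nonneg hα.le (sub_nonneg.2 ht)))
    have h2 : 0 ≤ K * ‖x t₀‖ ^ 2 := by positivity
    have h3 := mul_le_mul_of_nonneg_left h1 h2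
    nlinarith [h t₀ ht₀ x hx hr t ht, sq_nonneg ‖x t₀‖, sq_nonneg (K * ‖x t₀‖)]
  refine ⟨hex, fun ε hε => ?_, fun r hr => ?_, fun r hr ε hε => ?_⟩
  · obtain ⟨K, hK, h⟩ := hbound 1
    refine ⟨min 1 (ε / (K + 1)), by positivity, fun t₀ ht₀ x hx hlt t ht => ?_⟩
    have h1 := (lt_min_iff.1 hlt).2
    rw [lt_div_iff₀ (by positivity)] at h1
    have := h t₀ ht₀ x hx (lt_min_iff.1 hlt).1 t ht
    linarith
  · obtain ⟨K, hK, h⟩ := hbound r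
    refine ⟨(K + 1) * r, by positivity, fun t₀ ht₀ x hx hlt t ht => ?_⟩
    exact (h t₀ ht₀ x hx hlt t ht).trans_lt (by gcongr)
  · obtain ⟨K, hK, α, hα, h⟩ := hdec r
    -- Chosen so that `1 + s ≤ exp s` already brings `K r² exp (-α (t - t₀))` below `ε²`.
    refine ⟨K * r ^ 2 / (α * ε ^ 2), by positivity, fun t₀ ht₀ x hx hlt t ht => ?_⟩
    refine lt_of_pow_lt_pow_left₀ 2 hε.le ?_
    have hS : 0 < K * r ^ 2 / (α * ε ^ 2) := by positivity
    refine (h t₀ ht₀ x hx hlt t (by linarith)).trans_lt ?_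
    rw [Real.exp_neg, ← div_eq_mul_inv, div_lt_iff₀ (Real.exp_pos _)]
    have h1 := Real.add_one_le_exp (α * (t - t₀))
    have h2 : K * r ^ 2 ≤ α * (t - t₀) * ε ^ 2 := by
      have h3 : K * r ^ 2 / (α * ε ^ 2) ≤ t - t₀ := by linarith
      rw [div_le_iff₀ (by positivity)] at h3
      linarith
    have h4 : K * ‖x t₀‖ ^ 2 ≤ K * r ^ 2 := by gcongr
    have h5 : ε ^ 2 * (α * (t - t₀) + 1) ≤ ε ^ 2 * Real.exp (α * (t - t₀)) := by gcongr
    nlinarith [sq_pos_of_pos hε]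

end Stability

/-! ### Existence of closed-loop solutions -/

section Existence

variable {P : Params} {Gp Gv : Gain} {ref : ℝ → Vec3}

/-- Yaw angle of the vehicle at the position error `e`. -/
def yaw (ref : ℝ → Vec3) (t : ℝ) (e : Vec3) : ℝ := ref t 2 - e 2

/-- Body-frame velocity of the vehicle at the position error `e` and the body-frame velocity
error `z`. -/
noncomputable def velocity (ref : ℝ → Vec3) (t : ℝ) (e z : Vec3) : Vec3 :=
  (R (yaw ref t e))ᵀ *ᵥ deriv ref t - z

/-- Vector field of the undisturbed error system. -/
noncomputable def errorField (P : Params) (Gp Gv : Gain) (ref : ℝ → Vec3)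
    (p : ℝ × Vec3 × Vec3) : Vec3 × Vec3 :=
  (R (yaw ref p.1 p.2.1) *ᵥ p.2.2,
    -(P.M⁻¹ *ᵥ (P.C (velocity ref p.1 p.2.1 p.2.2) *ᵥ p.2.2
      + P.D (velocity ref p.1 p.2.1 p.2.2) *ᵥ p.2.2
      + feedback Gp Gv (yaw ref p.1 p.2.1) p.2.1 p.2.2)))

theorem locallyLipschitz_fst_snd : LocallyLipschitz fun p : ℝ × Vec3 × Vec3 => p.2.1 :=
  LipschitzWith.prod_fst.locallyLipschitz.comp LipschitzWith.prod_snd.locallyLipschitz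

theorem locallyLipschitz_snd_snd : LocallyLipschitz fun p : ℝ × Vec3 × Vec3 => p.2.2 :=
  LipschitzWith.prod_snd.locallyLipschitz.comp LipschitzWith.prod_snd.locallyLipschitz

theorem locallyLipschitz_yaw_error (href : ContDiff ℝ 2 ref) :
    LocallyLipschitz fun p : ℝ × Vec3 × Vec3 => yaw ref p.1 p.2.1 :=
  (((locallyLipschitz_ref href).comp LipschitzWith.prod_fst.locallyLipschitz).eval 2).sub
    (locallyLipschitz_fst_snd.eval 2)

theorem locallyLipschitz_velocity (href : ContDiff ℝ 2 ref) :
    LocallyLipschitz fun p : ℝ × Vec3 × Vec3 => velocity ref p.1 p.2.1 p.2.2 :=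
  (locallyLipschitz_R_transpose_mulVec (locallyLipschitz_yaw_error href)
    (((contDiff_deriv href).locallyLipschitz (𝕂 := ℝ)).comp
      LipschitzWith.prod_fst.locallyLipschitz)).sub locallyLipschitz_snd_snd

theorem locallyLipschitz_errorField (hGp : Gp.Admissible) (hGv : Gv.Admissible)
    (href : ContDiff ℝ 2 ref) : LocallyLipschitz (errorField P Gp Gv ref) := by
  refine LocallyLipschitz.prodMk (locallyLipschitz_R_mulVec (locallyLipschitz_yaw_error href)
    locallyLipschitz_snd_snd) ?_
  refine LocallyLipschitz.neg ?_
  exact LocallyLipschitz.mulVec (fun _ _ => LocallyLipschitz.const _)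
    (((locallyLipschitz_C_mulVec P (locallyLipschitz_velocity href) locallyLipschitz_snd_snd).add
      (locallyLipschitz_D_mulVec P (locallyLipschitz_velocity href)
        locallyLipschitz_snd_snd)).add
      (locallyLipschitz_feedback hGp hGv (locallyLipschitz_yaw_error href)
        locallyLipschitz_fst_snd locallyLipschitz_snd_snd))

theorem errorField_equation (hM : P.M.PosDef) (t : ℝ) (e z : Vec3) :
    P.M *ᵥ (errorField P Gp Gv ref (t, e, z)).2 + P.C (velocity ref t e z) *ᵥ z
      + P.D (velocity ref t e z) *ᵥ z + feedback Gp Gv (yaw ref t e) e z + 0 = 0 := by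
  have h : P.M * P.M⁻¹ = 1 := Matrix.mul_nonsing_inv _ hM.det_pos.ne'.isUnit
  simp only [errorField]
  rw [Matrix.mulVec_neg, Matrix.mulVec_mulVec, h, Matrix.one_mulVec]
  abel

theorem differentiable_energy (P : Params) (hGp : Gp.Admissible) :
    Differentiable ℝ fun p : Vec3 × Vec3 => energy P Gp p.1 p.2 := by
  refine Differentiable.fun_sum fun j _ => Differentiable.add (by fun_prop) ?_
  have h : Differentiable ℝ (Gp.potential j) := fun x =>
    (Gain.hasDerivAt_potential hGp j x).differentiableAt
  exact h.comp (by fun_prop)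

theorem lineDeriv_energy_errorField_nonpos (hM : P.M.PosDef) (hD : ∀ ν : Vec3, (P.D ν).PosDef)
    (hGp : Gp.Admissible) (hGv : Gv.Admissible) (t : ℝ) (p : Vec3 × Vec3) :
    lineDeriv ℝ (fun p : Vec3 × Vec3 => energy P Gp p.1 p.2) p
      (errorField P Gp Gv ref (t, p)) ≤ 0 := by
  obtain ⟨e, z⟩ := p
  obtain ⟨c, hc, hdamp⟩ := P.exists_damping_ge hD
  set v := errorField P Gp Gv ref (t, e, z) with hv
  -- Along a straight line the general formula for the energy rate computes the line derivative.
  have hline : ∀ a b : Vec3, HasDerivAt (fun s : ℝ => a + s • b) b 0 := fun a b => by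
    simpa using ((hasDerivAt_id (0 : ℝ)).smul_const b).const_add a
  have h := hasDerivAt_energy P hGp (hline e v.1) (hline z v.2)
  simp only [zero_smul, add_zero] at h
  have h' : HasLineDerivAt ℝ (fun p : Vec3 × Vec3 => energy P Gp p.1 p.2) _ (e, z) v := h
  rw [h'.lineDeriv]
  have hv1 : v.1 = R (yaw ref t e) *ᵥ z := rfl
  rw [hv1, energy_rate (errorField_equation hM t e z), dotProduct_zero]
  have h1 : c * (z ⬝ᵥ z) ≤ z ⬝ᵥ P.D (velocity ref t e z) *ᵥ z :=
    le_diagonal_quadratic (hdamp _) z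
  have h2 := K_quadratic_nonneg hGv (R (yaw ref t e) *ᵥ z) (R (yaw ref t e) *ᵥ z)
  have h3 := mul_nonneg hc.le (dotProduct_self_nonneg z)
  linarith

/-- The system is solved in the coordinates `(e, z)`, where the energy does not involve time, and
pose and velocity are then recovered from the reference. The initial velocity error is given in the
earth frame, hence the rotation of `x₀.2`. -/
theorem exists_isErrorTrajectory (hM : P.M.PosDef) (hD : ∀ ν : Vec3, (P.D ν).PosDef)
    (hGp : Gp.Admissible) (hGv : Gv.Admissible) (href : ContDiff ℝ 2 ref) (t₀ : ℝ)
    (x₀ : Vec3 × Vec3) : ∃ x, IsErrorTrajectory P Gp Gv ref t₀ x ∧ x t₀ = x₀ := by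
  obtain ⟨y, hy0, hy⟩ := exists_hasDerivWithinAt_Ici_of_lyapunov
    (locallyLipschitz_errorField (P := P) hGp hGv href) (differentiable_energy P hGp)
    (lineDeriv_energy_errorField_nonpos hM hD hGp hGv) (fun c => by
      obtain ⟨ρ, hρ⟩ := exists_norm_le_of_energy_le hM hGp c
      exact ⟨ρ, fun p hp => norm_prod_le_iff.2 (hρ p.1 p.2 hp)⟩) t₀
    (x₀.1, (R (yaw ref t₀ x₀.1))ᵀ *ᵥ x₀.2)
  set η : ℝ → Vec3 := fun t => ref t - (y t).1 with hη
  set ν : ℝ → Vec3 := fun t => velocity ref t (y t).1 (y t).2 with hν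
  have hpos : ∀ t, posErr ref t (η t) = (y t).1 := fun t => sub_sub_cancel _ _
  have hbody : ∀ t, bodyErr ref t (η t) (ν t) = (y t).2 := fun t => sub_sub_cancel _ _
  have hvel : ∀ t, velErr ref t (η t) (ν t) = R (yaw ref t (y t).1) *ᵥ (y t).2 := fun t => by
    rw [velErr_eq, hbody]
    rfl
  have hkin : ∀ t, deriv ref t - R (yaw ref t (y t).1) *ᵥ (y t).2 = R (η t 2) *ᵥ ν t :=
    fun t => by rw [← hvel, velErr, sub_sub_cancel]
  refine ⟨fun t => (posErr ref t (η t), velErr ref t (η t) (ν t)),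
    ⟨η, ν, fun T hT => ⟨fun t ht => ?_, ?_, ?_⟩, fun _ _ => rfl⟩, ?_⟩
  · have h := ((hasDerivAt_ref href t).hasDerivWithinAt (s := Set.Icc t₀ T)).sub
      ((hasFDerivAt_fst.comp_hasDerivWithinAt t (hy t ht.1)).mono Set.Icc_subset_Ici_self)
    rw [← hkin]
    exact h
  · have hyc : ContinuousOn y (Set.Icc t₀ T) := fun t ht =>
      (hy t ht.1).continuousWithinAt.mono Set.Icc_subset_Ici_self
    have hfc : ContinuousOn (fun t => errorField P Gp Gv ref (t, y t)) (Set.Icc t₀ T) :=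
      (locallyLipschitz_errorField (P := P) hGp hGv href).continuous.comp_continuousOn
        (f := fun t => (t, y t)) (continuousOn_id.prodMk hyc)
    obtain ⟨L, hL⟩ := isCompact_Icc.exists_bound_of_continuousOn hfc
    have hlip := (convex_Icc t₀ T).lipschitzOnWith_of_nnnorm_hasDerivWithin_le (C := L.toNNReal)
      (fun t ht => (hy t ht.1).mono Set.Icc_subset_Ici_self) (fun t ht => by
        rw [← NNReal.coe_le_coe, coe_nnnorm]
        exact (hL t ht).trans (Real.le_coe_toNNReal L))
    have hyac : AbsolutelyContinuousOnInterval y t₀ T := by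
      refine LipschitzOnWith.absolutelyContinuousOnInterval (K := L.toNNReal) ?_
      rwa [Set.uIcc_of_le hT]
    have hid : AbsolutelyContinuousOnInterval (fun t : ℝ => t) t₀ T :=
      (LipschitzWith.id.lipschitzOnWith).absolutelyContinuousOnInterval
    exact LocallyLipschitz.comp_absolutelyContinuousOnInterval (f := fun t => (t, y t))
      (g := fun p => velocity ref p.1 p.2.1 p.2.2) (locallyLipschitz_velocity href)
      (hid.prodMk hyac)
  · have hIoo : ∀ᵐ t ∂(volume.restrict (Set.Icc t₀ T)), t ∈ Set.Ioo t₀ T := by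
      rw [← restrict_Ioo_eq_restrict_Icc]
      exact ae_restrict_mem measurableSet_Ioo
    filter_upwards [hIoo] with t ht
    have hyt : HasDerivAt y (errorField P Gp Gv ref (t, y t)) t :=
      (hy t ht.1.le).hasDerivAt (Ici_mem_nhds ht.1)
    have hy1 : HasDerivAt (fun s => (y s).1) (R (yaw ref t (y t).1) *ᵥ (y t).2) t :=
      (ContinuousLinearMap.fst ℝ Vec3 Vec3).hasFDerivAt.comp_hasDerivAt t hyt
    have hy2 : HasDerivAt (fun s => (y s).2) (errorField P Gp Gv ref (t, y t)).2 t :=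
      (ContinuousLinearMap.snd ℝ Vec3 Vec3).hasFDerivAt.comp_hasDerivAt t hyt
    have hηt : HasDerivAt η (R (η t 2) *ᵥ ν t) t := by
      rw [← hkin]
      exact (hasDerivAt_ref href t).sub hy1
    have hyaw : HasDerivAt (fun s => η s 2) (ν t 2) t := by
      have := hasDerivAt_pi.1 hηt 2
      rwa [R_mulVec_apply_two] at this
    refine ⟨_, (hasDerivAt_R_transpose_mulVec hyaw (hasDerivAt_deriv_ref href t)).sub hy2,
      (dynamics_iff ..).2 ?_⟩
    rw [sub_sub_cancel, hpos, hbody]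
    exact errorField_equation hM t (y t).1 (y t).2
  · simp only [hpos, hvel, hy0, R_mulVec_transpose_mulVec]

end Existence

end AUV

theorem theorem1 (P : AUV.Params) (hM : P.M.PosDef) (hD : ∀ ν : AUV.Vec3, (P.D ν).PosDef)
    (Gp Gv : AUV.Gain) (hGp : Gp.Admissible) (hGv : Gv.Admissible) :
    -- both gain matrices are positive definite at every error
    (∀ e : AUV.Vec3, (Gp.K e).PosDef ∧ (Gv.K e).PosDef) ∧
    -- without disturbance, zero is asymptotically stable for the tracking error
    (∀ ref : ℝ → AUV.Vec3, ContDiff ℝ 2 ref → (∃ B : ℝ, ∀ t, 0 ≤ t → ‖deriv ref t‖ ≤ B) →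
      AUV.IsGloballyUniformlyAsymptoticallyStable (AUV.IsErrorTrajectory P Gp Gv ref)) ∧
    -- with disturbance, the cost from zero initial error is nonpositive
    (∃ ε : ℝ, 0 < ε ∧ ∀ ref : ℝ → AUV.Vec3, ContDiff ℝ 2 ref →
      ∀ w : ℝ → AUV.Vec3, Measurable w → (∃ B : ℝ, ∀ t, 0 ≤ t → ‖w t‖ ≤ B) →
      ∀ T : ℝ, 0 ≤ T → ∀ η ν : ℝ → AUV.Vec3,
        AUV.IsSolutionOn P Gp Gv ref w 0 T η ν →
        AUV.posErr ref 0 (η 0) = 0 → AUV.velErr ref 0 (η 0) (ν 0) = 0 →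
        ∫ t in (0 : ℝ)..T,
          (AUV.velErr ref t (η t) (ν t) ⬝ᵥ AUV.velErr ref t (η t) (ν t)
            - ε ^ 2 * (w t ⬝ᵥ w t)) ≤ 0) := by
  refine ⟨fun e => ⟨AUV.Gain.K_posDef hGp e, AUV.Gain.K_posDef hGv e⟩, fun ref href ⟨B, hB⟩ => ?_, ?_⟩
  · exact AUV.isGloballyUniformlyAsymptoticallyStable_of_exponential_decay
      (fun t₀ _ x₀ => AUV.exists_isErrorTrajectory hM hD hGp hGv href t₀ x₀)
      (AUV.exists_exponential_decay hM hD hGp hGv href hB)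
  · obtain ⟨c, hc, hdamp⟩ := P.exists_damping_ge hD
    -- The gain depends only on the damping bound, and is fixed before the reference and the
    -- disturbance.
    exact ⟨c⁻¹, inv_pos.2 hc, fun ref href w hw ⟨B, hB⟩ T hT η ν h he hv =>
      h.integral_velErr_le hM hGp hGv href hc hdamp hw (fun t ht => hB t ht.1) hT he hv⟩
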